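/- Let $n\ge 1$ and let $R$ be the root system of type $B_n$ or $C_n$, realized in $\mathbb R^n$ with standard basis $\varepsilon_1,\dots,\varepsilon_n$ and with simple roots numbered so that $\alpha_1$ is the special node: $\alpha_1=\varepsilon_1$ in type $B_n$, $\alpha_1=2\varepsilon_1$ in type $C_n$, and $\alpha_i=\varepsilon_i-\varepsilon_{i-1}$ for $2\le i\le n$. The Weyl group $W$ is generated by the simple reflections $s_1,\dots,s_n$; an element $w\in W$ is written as a signed permutation $w=(w(1),\dots,w(n))$, where $w(\varepsilon_k)=\varepsilon_{w(k)}$ and $\varepsilon_{-a}=-\varepsilon_a$. Let $\omega_1,\dots,\omega_n$ be the fundamental weights, $1\le r\le n$, $I_r=\{\alpha_r\}$, and let $W^{I_r}$ be the set of $w\in W$ such that $w(\alpha_j)$ is a positive root for all $j\ne r$, ordered by the Bruhat order. For a weight $\mu$, write $\mu\ge 0$ if $\mu$ is a linear combination of simple roots with nonnegative real coefficients. Call $v\in W^{I_r}$ *maximal* if it is a maximal element of $\{v\in W^{I_r}: v(\omega_r)\ge 0\}$ in the Bruhat order. For integers $s\le t$ and $m\ge 0$ let $J_{m,[s,t]}$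 be the set of sequences $\underline i=(i_1,\dots,i_m)$ of integers in $[s,t]$ with $i_{k+1}-i_k\ge 2$ for all $k$; put $\underline i'=(i_1-1,\dots,i_m-1)$, $-\underline i'=(-(i_m-1),\dots,-(i_1-1))$, $[\underline i]=\{i_1,\dots,i_m\}$, and let $S{\uparrow}$ be the elements of a finite set $S$ of integers in increasing order. The maximal elements are the following, both in type $B_n$ and in type $C_n$. (i) If $r=1$, there is exactly one maximal element, namely $$v=\begin{cases}(-(n-1),-(n-3),\dots,-3,-1,2,4,\dots,n-2,n), & n\text{ even},\\ (-(n-1),-(n-3),\dots,-4,-2,1,3,5,\dots,n-2,n), & n\text{ odd}.\end{cases}$$ (ii) Let $2\le r\le n-1$ and $n+1-r=2m$. For every $\underline i\in J_{m,[2,n]}$ there is a unique $v_{\underline i}\in W^{I_r}$ with $v_{\underline i}(\omega_r)=\sum_{k=1}^m\alpha_{i_k}$; it is maximal, and $$v_{\underline i}=\bigl(([1,n]\setminus([\underline i]\cup[\underline i'])){\uparrow},\,-\underline i',\,\underline i\bigr).$$ Every maximal element equals $v_{\underline i}$ for exactly one $\underline i\in J_{m,[2,n]}$. (iii) Let $2\le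 r\le n-1$ and $n+1-r=2m+1$. For every $\underline i\in J_{m,[3,n]}$ there is a unique $v_{\underline i}\in W^{I_r}$ with $v_{\underline i}(\omega_r)=\alpha_1+\sum_{k=1}^m\alpha_{i_k}$ in type $B_n$, respectively $v_{\underline i}(\omega_r)=\tfrac12\alpha_1+\sum_{k=1}^m\alpha_{i_k}$ in type $C_n$; it is maximal, and $$v_{\underline i}=\bigl(([1,n]\setminus(\{1\}\cup[\underline i]\cup[\underline i'])){\uparrow},\,-\underline i',\,1,\,\underline i\bigr).$$ Every maximal element equals $v_{\underline i}$ for exactly one $\underline i\in J_{m,[3,n]}$. (iv) If $r=n$, there is exactly one maximal element, namely $v=(2,3,4,\dots,n-1,n,1)$. -/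

import Mathlib

namespace TypeBC

/-- The two types of root systems under consideration. -/
inductive Kind
  | B
  | C

/-- The real vector space `X(T) ⊗ ℝ`, with its standard Weyl-invariant inner product. -/
abbrev E (n : ℕ) := EuclideanSpace ℝ (Fin n)

/-- The vectors `ε_a` for `a ∈ {±1, …, ±n}`: `ε_1, …, ε_n` is the standard basis (the index `j` of
`Fin n` stands for the coordinate number `j + 1`), and `ε_{-a} = -ε_a`. -/
noncomputable def eps (n : ℕ) (a : ℤ) : E n :=
  WithLp.toLp 2 fun j : Fin n =>
    if a = (j : ℤ) + 1 then 1 else if a = -((j : ℤ) + 1) then -1 else 0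

/-- The simple roots `α_1, …, α_n`, where `α_1` is the special node of the Dynkin diagram:
`α_1 = ε_1` in type `B_n`, `α_1 = 2 ε_1` in type `C_n`, and `α_i = ε_i - ε_{i-1}` for `i ≥ 2`. -/
noncomputable def simpleRoot (t : Kind) (n : ℕ) (i : ℤ) : E n :=
  if i = 1 then
    match t with
    | .B => eps n 1
    | .C => (2 : ℝ) • eps n 1
  else eps n i - eps n (i - 1)

/-- The positive roots `R⁺`: `ε_j ± ε_i` for `1 ≤ i < j ≤ n`, together with `ε_i` (type `B_n`) or
`2 ε_i` (type `C_n`) for `1 ≤ i ≤ n`. -/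
def IsPosRoot (t : Kind) (n : ℕ) (β : E n) : Prop :=
  (∃ i : ℤ, 1 ≤ i ∧ i ≤ n ∧
    β = match t with
      | .B => eps n i
      | .C => (2 : ℝ) • eps n i) ∨
  ∃ i j : ℤ, 1 ≤ i ∧ i < j ∧ j ≤ n ∧ (β = eps n j - eps n i ∨ β = eps n j + eps n i)

/-- The number `⟨χ, α^∨⟩ = 2 (χ, α) / (α, α)`. -/
noncomputable def corootPairing {n : ℕ} (χ α : E n) : ℝ :=
  2 * inner ℝ χ α / inner ℝ α α

/-- The reflection `s_α`, as a linear isometry. -/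
noncomputable def refl {n : ℕ} (α : E n) : E n ≃ₗᵢ[ℝ] E n :=
  (Submodule.span ℝ {α})ᗮ.reflection

theorem refl_apply {n : ℕ} (α χ : E n) : refl α χ = χ - corootPairing χ α • α := by
  unfold refl corootPairing
  rw [Submodule.reflection_orthogonal_apply, Submodule.reflection_singleton_apply,
    real_inner_self_eq_norm_sq, real_inner_comm]
  simp only [RCLike.ofReal_real_eq_id, id_eq, neg_sub, two_smul, ← add_smul]
  congr 2
  ring

/-- The fundamental weight `ω_r`: `ω_r = ε_r + ⋯ + ε_n`, except that
`ω_1 = ½ (ε_1 + ⋯ + ε_n)` in type `B_n`. See `corootPairing_fundWeight` for `⟨ω_r, α_j^∨⟩ = δ_{rj}`. -/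
noncomputable def fundWeight (t : Kind) (n : ℕ) (r : ℤ) : E n :=
  match t with
  | .B => if r = 1 then (1 / 2 : ℝ) • ∑ k ∈ Finset.Icc (1 : ℤ) n, eps n k
      else ∑ k ∈ Finset.Icc r (n : ℤ), eps n k
  | .C => ∑ k ∈ Finset.Icc r (n : ℤ), eps n k

theorem eps_succ (n : ℕ) (j : Fin n) : eps n ((j : ℤ) + 1) = EuclideanSpace.single j (1 : ℝ) := by
  ext k
  simp only [eps, PiLp.single_apply]
  by_cases h : k = j
  · simp [h]
  · have h1 : (k : ℤ) ≠ j := by simpa [Fin.ext_iff] using h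
    have h2 : ¬ ((j : ℤ) + 1 = k + 1) := by omega
    have h3 : ¬ ((j : ℤ) + 1 = -((k : ℤ) + 1)) := by omega
    rw [if_neg h2, if_neg h3, if_neg h]

theorem inner_eps (n : ℕ) (a b : ℤ) (ha : 1 ≤ a) (han : a ≤ n) (hb : 1 ≤ b) (hbn : b ≤ n) :
    inner ℝ (eps n a) (eps n b) = if a = b then (1 : ℝ) else 0 := by
  obtain ⟨x, hx⟩ : ∃ x : Fin n, (x : ℤ) + 1 = a := ⟨⟨(a - 1).toNat, by omega⟩, by simp only; omega⟩
  obtain ⟨y, hy⟩ : ∃ y : Fin n, (y : ℤ) + 1 = b := ⟨⟨(b - 1).toNat, by omega⟩, by simp only; omega⟩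
  rw [← hx, ← hy, eps_succ, eps_succ]
  simp [Fin.ext_iff, EuclideanSpace.inner_single_left]

theorem inner_eps_sum (n : ℕ) (r b : ℤ) (hr : 1 ≤ r) (hb : 1 ≤ b) (hbn : b ≤ n) :
    inner ℝ (∑ k ∈ Finset.Icc r (n : ℤ), eps n k) (eps n b) = if r ≤ b then (1 : ℝ) else 0 := by
  have key : ∀ k ∈ Finset.Icc r (n : ℤ),
      inner ℝ (eps n k) (eps n b) = if k = b then (1 : ℝ) else 0 := by
    intro k hk
    rw [Finset.mem_Icc] at hk
    exact inner_eps n k b (by omega) hk.2 hb hbn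
  rw [sum_inner, Finset.sum_congr rfl key, Finset.sum_ite_eq']
  simp [hbn]

/-- The defining property `⟨ω_r, α_j^∨⟩ = δ_{rj}` of the fundamental weights. -/
theorem corootPairing_fundWeight (t : Kind) (n : ℕ) (r j : ℤ) (hr : 1 ≤ r) (hrn : r ≤ n)
    (hj : 1 ≤ j) (hjn : j ≤ n) :
    corootPairing (fundWeight t n r) (simpleRoot t n j) = if r = j then 1 else 0 := by
  have h11 := inner_eps n 1 1 (by omega) (by omega) (by omega) (by omega)
  by_cases h1 : j = 1
  · subst h1
    have hs := inner_eps_sum n r 1 hr (by omega) (by omega)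
    have hs1 := inner_eps_sum n 1 1 (by omega) (by omega) (by omega)
    by_cases h2 : r = 1
    · subst h2
      cases t <;>
        simp [-inner_self_eq_norm_sq_to_K, corootPairing, fundWeight, simpleRoot, inner_smul_left, inner_smul_right, h11, hs1]
    · have h3 : ¬ r ≤ 1 := by omega
      cases t <;>
        simp [-inner_self_eq_norm_sq_to_K, corootPairing, fundWeight, simpleRoot, inner_smul_left, inner_smul_right, h2, h3,
          hs]
  · have e1 := inner_eps n j j (by omega) (by omega) (by omega) (by omega)
    have e2 := inner_eps n (j - 1) (j - 1) (by omega) (by omega) (by omega) (by omega)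
    have e3 := inner_eps n j (j - 1) (by omega) (by omega) (by omega) (by omega)
    have e4 := inner_eps n (j - 1) j (by omega) (by omega) (by omega) (by omega)
    have s1 := inner_eps_sum n r j hr (by omega) (by omega)
    have s2 := inner_eps_sum n r (j - 1) hr (by omega) (by omega)
    have hd : inner ℝ (eps n j - eps n (j - 1)) (eps n j - eps n (j - 1)) = (2 : ℝ) := by
      rw [if_pos rfl] at e1 e2
      rw [if_neg (by omega)] at e3 e4
      simp only [inner_sub_left, inner_sub_right, e1, e2, e3, e4]
      norm_num
    have hn : inner ℝ (∑ k ∈ Finset.Icc r (n : ℤ), eps n k) (eps n j - eps n (j - 1)) =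
        if r = j then (1 : ℝ) else 0 := by
      rw [inner_sub_right, s1, s2]
      split_ifs <;> first | omega | norm_num
    by_cases h2 : r = 1
    · subst h2
      cases t <;>
        simp [-inner_self_eq_norm_sq_to_K, corootPairing, fundWeight, simpleRoot, inner_smul_left, h1, hd, hn, Ne.symm h1]
    · cases t <;> simp [-inner_self_eq_norm_sq_to_K, corootPairing, fundWeight, simpleRoot, h1, h2, hd, hn] <;>
        split_ifs <;> norm_num

/-- The Weyl group `W`, generated by the simple reflections `s_1, …, s_n`. -/
noncomputable def weylGroup (t : Kind) (n : ℕ) : Subgroup (E n ≃ₗᵢ[ℝ] E n) :=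
  Subgroup.closure {s | ∃ i : ℤ, 1 ≤ i ∧ i ≤ n ∧ s = refl (simpleRoot t n i)}

/-- The length `ℓ(w)`: the least number of factors in an expression of `w` as a product of simple
reflections. -/
noncomputable def coxeterLength {t : Kind} {n : ℕ} (w : weylGroup t n) : ℕ :=
  sInf {k | ∃ l : List ℤ, l.length = k ∧ (∀ i ∈ l, 1 ≤ i ∧ i ≤ n) ∧
    (w : E n ≃ₗᵢ[ℝ] E n) = (l.map fun i => refl (simpleRoot t n i)).prod}

/-- One step up in the Bruhat order: `w = s_β u` for a positive root `β`, and `ℓ(u) < ℓ(w)`. -/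
def BruhatStep {t : Kind} {n : ℕ} (u w : weylGroup t n) : Prop :=
  ∃ β : E n, IsPosRoot t n β ∧ (w : E n ≃ₗᵢ[ℝ] E n) = refl β * u ∧ coxeterLength u < coxeterLength w

/-- The Bruhat order `u ≤ w` on the Weyl group. -/
def BruhatLE {t : Kind} {n : ℕ} (u w : weylGroup t n) : Prop :=
  Relation.ReflTransGen BruhatStep u w

/-- The set `W^{I_r}`, with `I_r = {α_r}`: all `w ∈ W` such that `w(α_j)` is a positive root for every
simple root `α_j ≠ α_r`. -/
def minReps (t : Kind) (n : ℕ) (r : ℤ) : Set (weylGroup t n) :=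
  {w | ∀ j : ℤ, 1 ≤ j → j ≤ n → j ≠ r → IsPosRoot t n (w.1 (simpleRoot t n j))}

/-- `μ ≥ 0`: the vector `μ` is a linear combination of the simple roots with nonnegative real
coefficients. -/
def NonnegWeight (t : Kind) (n : ℕ) (μ : E n) : Prop :=
  ∃ c : ℤ → ℝ, (∀ j, 0 ≤ c j) ∧ μ = ∑ j ∈ Finset.Icc (1 : ℤ) n, c j • simpleRoot t n j

/-- The set of all `v ∈ W^{I_r}` that are maximal (in the Bruhat order on `W^{I_r}`) with the property
`v(ω_r) ≥ 0`. -/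
def maximalElements (t : Kind) (n : ℕ) (r : ℤ) : Set (weylGroup t n) :=
  {v | v ∈ minReps t n r ∧ NonnegWeight t n (v.1 (fundWeight t n r)) ∧
    ∀ u ∈ minReps t n r, NonnegWeight t n (u.1 (fundWeight t n r)) → BruhatLE v u → u = v}

/-- `w = (a_1, …, a_n)` as a signed permutation: `w(k) = a_k`, that is, `w(ε_k) = ε_{a_k}` for
`1 ≤ k ≤ n`. (The list `a` is indexed from `0`.) -/
def IsWindow {t : Kind} {n : ℕ} (w : weylGroup t n) (a : List ℤ) : Prop :=
  a.length = n ∧ ∀ (k : ℕ) (hk : k < a.length), w.1 (eps n ((k : ℤ) + 1)) = eps n a[k]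

/-- The set `J_{p,[s,t]}` of sequences `(i_1, …, i_p)` in `[s,t]` with `i_{k+1} - i_k ≥ 2`. -/
def gapSeqs (p : ℕ) (s t : ℤ) : Set (List ℤ) :=
  {i | i.length = p ∧ (∀ x ∈ i, s ≤ x ∧ x ≤ t) ∧ i.IsChain fun x y => 2 ≤ y - x}

/-- The sequence `i' = (i_1 - 1, …, i_m - 1)`. -/
def predSeq (i : List ℤ) : List ℤ := i.map fun x => x - 1

/-- The sequence `-i = (-i_m, …, -i_1)`. -/
def negRev (i : List ℤ) : List ℤ := (i.map fun x => -x).reverse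

/-- The window `([1,n] ∖ {[i],[i']} ↑, -i', i)`. -/
noncomputable def windowEven (n : ℕ) (i : List ℤ) : List ℤ :=
  (Finset.Icc (1 : ℤ) n \ (i.toFinset ∪ (predSeq i).toFinset)).sort (· ≤ ·) ++ negRev (predSeq i) ++ i

/-- The window `([1,n] ∖ {1,[i],[i']} ↑, -i', 1, i)`. -/
noncomputable def windowOdd (n : ℕ) (i : List ℤ) : List ℤ :=
  (Finset.Icc (1 : ℤ) n \ ({1} ∪ i.toFinset ∪ (predSeq i).toFinset)).sort (· ≤ ·) ++
    negRev (predSeq i) ++ [1] ++ i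

/-- The weight `∑_k α_{i_k}`. -/
noncomputable def rootSum (t : Kind) (n : ℕ) (i : List ℤ) : E n :=
  (i.map (simpleRoot t n)).sum

/-- The coefficient of `α_1` in the odd case: `1` in type `B_n`, and `½` in type `C_n`. -/
noncomputable def alphaOneCoeff : Kind → ℝ
  | .B => 1
  | .C => 1 / 2

end TypeBC

namespace TypeBC

/-! Everything is read off from the weight x = v(ω_r). An element of W^{I_r} is determined by x
(`minReps_ext`). The possible x are exactly the vectors of the length of ω_r with coordinates in {0,
κ, -κ}, where κ = `weightScale t r` (`hasSignCoords_apply_fundWeight`, `exists_minReps`). Put c_j =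
(x_j + ⋯ + x_n)/κ. This is an integer walk with steps in {-1, 0, 1} ending at c_{n+1} = 0. Up to
positive factors the c_j are the coefficients of x in the simple roots, so v(ω_r) ≥ 0 means c ≥ 0
(`nonnegWeight_iff`).

Going up in the Bruhat order can only lower each c_j (`BruhatLE.inner_le`). Conversely, if x pairs
positively with α_i, then s_i v is above v and still in W^{I_r}, and only c_i changes. So for a
maximal v no single c_i can be lowered by s_i without becoming negative. An elementary argument on
walks (`IsWalk.isFlatAt`) shows that then c is the indicator function of a set T ⊆ [1,n] without
consecutive elements. Equivalently, x = κ ∑_{i ∈ T} α_i, with α_1 read as ε_1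
(`exists_isGapSet_of_mem_maximalElements`).

Conversely, let v have such a weight and let u ≥ v have nonnegative weight. The walk of u lies
between 0 and the indicator of T, so it is the indicator of some U ⊆ T. Comparing lengths gives |U|
+ |U ∖ {1}| = n + 1 - r = |T| + |T ∖ {1}|, hence U = T and u = v (`IsGapSet.mem_maximalElements`).

Maximal elements therefore correspond to sets T without consecutive elements and with |T| + |T ∖
{1}| = n + 1 - r. The parity of n + 1 - r decides whether 1 ∈ T. For r = 1 and r = n only one T is
possible. The window lists the zero coordinates of x and then its signed nonzero ones, each block
increasing (`isWindow_append`). -/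

/-! ### Coordinates with respect to the vectors ε_a. -/

theorem eps_neg (n : ℕ) (a : ℤ) : eps n (-a) = -eps n a := by
  ext k
  simp only [eps, PiLp.neg_apply]
  split_ifs <;> first | omega | norm_num

theorem exists_fin_eq {n : ℕ} {a : ℤ} (h1 : 1 ≤ a) (h2 : a ≤ n) :
    ∃ j : Fin n, (j : ℤ) + 1 = a :=
  ⟨⟨(a - 1).toNat, by omega⟩, by simp only; omega⟩

theorem inner_eps_eps {n : ℕ} {b : ℤ} (hb : 1 ≤ b) (hbn : b ≤ n) (a : ℤ) :
    inner ℝ (eps n a) (eps n b) = if a = b then (1 : ℝ) else if a = -b then -1 else 0 := by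
  obtain ⟨j, rfl⟩ := exists_fin_eq hb hbn
  rw [eps_succ, EuclideanSpace.inner_single_right]
  simp [eps]

theorem inner_eps_eq_apply {n : ℕ} (x : E n) (j : Fin n) :
    inner ℝ x (eps n ((j : ℤ) + 1)) = x j := by
  rw [eps_succ, EuclideanSpace.inner_single_right]
  simp

theorem ext_inner_eps {n : ℕ} {x y : E n}
    (h : ∀ a : ℤ, 1 ≤ a → a ≤ n → inner ℝ x (eps n a) = inner ℝ y (eps n a)) : x = y := by
  ext j
  have := h ((j : ℤ) + 1) (by omega) (by omega)
  rwa [inner_eps_eq_apply, inner_eps_eq_apply] at this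

theorem sum_Icc_eq_sum_fin {M : Type*} [AddCommMonoid M] (n : ℕ) (f : ℤ → M) :
    ∑ a ∈ Finset.Icc (1 : ℤ) n, f a = ∑ j : Fin n, f ((j : ℤ) + 1) := by
  symm
  refine Finset.sum_bij (fun j _ => (j : ℤ) + 1) ?_ ?_ ?_ ?_
  · intro j _
    rw [Finset.mem_Icc]
    omega
  · intro a _ b _ h
    exact Fin.ext (by simpa using h)
  · intro a ha
    rw [Finset.mem_Icc] at ha
    obtain ⟨j, hj⟩ := exists_fin_eq ha.1 ha.2
    exact ⟨j, Finset.mem_univ _, hj⟩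
  · intros
    rfl

theorem inner_self_eq_sum {n : ℕ} (x : E n) :
    inner ℝ x x = ∑ a ∈ Finset.Icc (1 : ℤ) n, inner ℝ x (eps n a) ^ 2 := by
  rw [sum_Icc_eq_sum_fin]
  simp only [inner_eps_eq_apply]
  rw [PiLp.inner_apply]
  simp [sq]

/-- The indices `±1, …, ±n`. -/
abbrev IsIndex (n : ℕ) (a : ℤ) : Prop := a ≠ 0 ∧ -(n : ℤ) ≤ a ∧ a ≤ n

theorem eps_injective {n : ℕ} {a b : ℤ} (ha : IsIndex n a)
    (h : eps n a = eps n b) : a = b := by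
  rcases le_or_gt 0 a with h3 | h3
  · have h5 := inner_eps_eps (n := n) (b := a) (by omega) (by omega) b
    have h6 := inner_eps_eps (n := n) (b := a) (by omega) (by omega) a
    rw [← h, h6, if_pos rfl] at h5
    split_ifs at h5 with h7 h8
    · exact h7.symm
    · norm_num at h5
    · norm_num at h5
  · have h5 := inner_eps_eps (n := n) (b := -a) (by omega) (by omega) b
    have h6 := inner_eps_eps (n := n) (b := -a) (by omega) (by omega) a
    rw [← h, h6, if_neg (by omega), if_pos (by omega)] at h5
    split_ifs at h5 with h7 h8
    · norm_num at h5
    · omega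
    · norm_num at h5

/-! ### Reflections and their action on the ε_a. -/

theorem inner_refl_left {n : ℕ} (α x y : E n) :
    inner ℝ (refl α x) y = inner ℝ x (refl α y) := by
  simp only [refl_apply, corootPairing, inner_sub_left, inner_sub_right, inner_smul_left,
    inner_smul_right]
  rw [real_inner_comm y α]
  simp
  ring

theorem refl_mul_self {n : ℕ} (α : E n) : refl α * refl α = 1 := by
  ext1 x
  simp [refl]

theorem refl_refl {n : ℕ} (α x : E n) : refl α (refl α x) = x :=
  congrArg (fun f : E n ≃ₗᵢ[ℝ] E n => f x) (refl_mul_self α)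

theorem refl_smul {n : ℕ} (α : E n) {c : ℝ} (hc : c ≠ 0) : refl (c • α) = refl α := by
  unfold refl
  have : Submodule.span ℝ {c • α} = Submodule.span ℝ {α} :=
    Submodule.span_singleton_smul_eq (IsUnit.mk0 c hc) α
  simp only [this]

theorem refl_map {n : ℕ} (g : E n ≃ₗᵢ[ℝ] E n) (α : E n) : refl (g α) = g * refl α * g⁻¹ := by
  ext1 x
  obtain ⟨y, rfl⟩ := g.surjective x
  have h : g⁻¹ (g y) = y := g.symm_apply_apply y
  simp only [LinearIsometryEquiv.coe_mul, Function.comp_apply, h, refl_apply, corootPairing,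
    LinearIsometryEquiv.inner_map_map, map_sub, map_smul]

/-- The factor by which the first simple root exceeds that of type `B`. -/
noncomputable def simpleScale (t : Kind) (i : ℤ) : ℝ :=
  match t with
  | .B => 1
  | .C => if i = 1 then 2 else 1

theorem simpleScale_pos (t : Kind) (i : ℤ) : 0 < simpleScale t i := by
  cases t
  · simp [simpleScale]
  · simp only [simpleScale]
    split_ifs <;> norm_num

theorem simpleRoot_eq_smul (t : Kind) (n : ℕ) (i : ℤ) :
    simpleRoot t n i = simpleScale t i • simpleRoot .B n i := by
  cases t
  · simp [simpleScale]
  · by_cases h : i = 1 <;> simp [simpleRoot, simpleScale, h]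

/-- A reflection depends only on the line of its root, and type C only doubles α_1. Computations
with reflections can therefore use the type B simple roots throughout. -/
theorem refl_simpleRoot (t : Kind) (n : ℕ) (i : ℤ) :
    refl (simpleRoot t n i) = refl (simpleRoot .B n i) := by
  rw [simpleRoot_eq_smul, refl_smul _ (simpleScale_pos t i).ne']

/-- The action of the simple reflection `s_i` on the indices of the vectors `ε_a`. -/
def signedSwap (i a : ℤ) : ℤ :=
  if i = 1 then (if a = 1 then -1 else if a = -1 then 1 else a)
  else if a = i then i - 1 else if a = i - 1 then i
  else if a = -i then 1 - i else if a = 1 - i then -i else a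

theorem refl_simpleRoot_one_eps (n : ℕ) (hn : 1 ≤ n) (a : ℤ) :
    refl (simpleRoot .B n 1) (eps n a) = eps n (signedSwap 1 a) := by
  have h0 := inner_eps_eps (n := n) (b := 1) le_rfl (by omega) a
  have h1 := inner_eps_eps (n := n) (b := 1) le_rfl (by omega) 1
  rw [if_pos rfl] at h1
  have e := eps_neg n 1
  simp only [refl_apply, corootPairing, simpleRoot, if_true, h0, h1, signedSwap]
  split_ifs with h2 h3
  · subst h2
    rw [e]
    module
  · subst h3
    rw [e]
    module
  · module

theorem refl_simpleRoot_eps_of_two_le {n : ℕ} {i : ℤ} (hi : 2 ≤ i) (hin : i ≤ n) (a : ℤ) :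
    refl (simpleRoot .B n i) (eps n a) = eps n (signedSwap i a) := by
  have h0 := inner_eps_eps (n := n) (b := i) (by omega) (by omega) a
  have h1 := inner_eps_eps (n := n) (b := i - 1) (by omega) (by omega) a
  have e1 := inner_eps n i i (by omega) (by omega) (by omega) (by omega)
  have e2 := inner_eps n (i - 1) (i - 1) (by omega) (by omega) (by omega) (by omega)
  have e3 := inner_eps n i (i - 1) (by omega) (by omega) (by omega) (by omega)
  have e4 := inner_eps n (i - 1) i (by omega) (by omega) (by omega) (by omega)
  have hd : inner ℝ (eps n i - eps n (i - 1)) (eps n i - eps n (i - 1)) = (2 : ℝ) := by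
    rw [if_pos rfl] at e1 e2
    rw [if_neg (by omega)] at e3 e4
    simp only [inner_sub_left, inner_sub_right, e1, e2, e3, e4]
    norm_num
  have n1 := eps_neg n i
  have n2 : eps n (1 - i) = - eps n (i - 1) := by rw [← eps_neg]; congr 1; ring
  have hi1 : i ≠ 1 := by omega
  simp only [refl_apply, corootPairing, simpleRoot, if_neg hi1, inner_sub_right (eps n a), h0, h1,
    hd, signedSwap]
  by_cases c1 : a = i
  · subst c1
    rw [if_pos rfl, if_neg (by omega), if_neg (by omega), if_pos rfl]
    module
  by_cases c2 : a = i - 1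
  · subst c2
    rw [if_neg (by omega), if_neg (by omega), if_pos rfl, if_neg (by omega), if_pos rfl]
    module
  by_cases c3 : a = -i
  · subst c3
    rw [if_neg (by omega), if_pos rfl, if_neg (by omega), if_neg (by omega), if_neg (by omega),
      if_neg (by omega), if_pos rfl, n1, n2]
    module
  by_cases c4 : a = 1 - i
  · subst c4
    rw [if_neg (by omega), if_neg (by omega), if_neg (by omega), if_pos (by omega),
      if_neg (by omega), if_neg (by omega), if_neg (by omega), if_pos rfl, n1, n2]
    module
  · rw [if_neg c1, if_neg c3, if_neg c2, if_neg (by omega), if_neg c1, if_neg c2, if_neg c3,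
      if_neg c4]
    module

theorem refl_simpleRoot_eps (t : Kind) {n : ℕ} {i : ℤ} (hi : 1 ≤ i) (hin : i ≤ n) (a : ℤ) :
    refl (simpleRoot t n i) (eps n a) = eps n (signedSwap i a) := by
  rw [refl_simpleRoot]
  rcases hi.eq_or_lt with rfl | h
  · exact refl_simpleRoot_one_eps n (by omega) a
  · exact refl_simpleRoot_eps_of_two_le h hin a

theorem isIndex_signedSwap {n : ℕ} {i a : ℤ} (hi : 1 ≤ i) (hin : i ≤ n) (ha : IsIndex n a) :
    IsIndex n (signedSwap i a) := by
  unfold signedSwap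
  split_ifs <;> omega

/-! ### Positive roots. -/

/-- The vector `∑ k ε_k`, which pairs positively with every positive root. -/
noncomputable def rho (n : ℕ) : E n := ∑ k ∈ Finset.Icc (1 : ℤ) n, (k : ℝ) • eps n k

theorem inner_rho_eps_of_pos {n : ℕ} {a : ℤ} (ha : 1 ≤ a) (han : a ≤ n) :
    inner ℝ (rho n) (eps n a) = a := by
  rw [rho, sum_inner, Finset.sum_eq_single a]
  · rw [inner_smul_left, inner_eps _ _ _ ha han ha han]
    simp
  · intro b hb hba
    rw [Finset.mem_Icc] at hb
    rw [inner_smul_left, inner_eps _ _ _ hb.1 hb.2 ha han, if_neg hba, mul_zero]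
  · intro h
    exact absurd (Finset.mem_Icc.2 ⟨ha, han⟩) h

theorem inner_rho_eps {n : ℕ} {a : ℤ} (ha : IsIndex n a) :
    inner ℝ (rho n) (eps n a) = a := by
  rcases le_or_gt 0 a with h3 | h3
  · exact inner_rho_eps_of_pos (by omega) (by omega)
  · have := inner_rho_eps_of_pos (n := n) (a := -a) (by omega) (by omega)
    rw [eps_neg, inner_neg_right] at this
    push_cast at this
    linarith

/-- Since (ρ, ε_a) = a for every signed index, this turns positivity of a root ε_b - ε_a into a < b,
which is how the defining condition of W^{I_r} becomes monotonicity of a signed permutation. -/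
theorem IsPosRoot.inner_rho_pos {t : Kind} {n : ℕ} {β : E n} (h : IsPosRoot t n β) :
    0 < inner ℝ (rho n) β := by
  rcases h with ⟨i, h1, h2, rfl⟩ | ⟨i, j, h1, h2, h3, rfl | rfl⟩
  · have := inner_rho_eps_of_pos h1 h2
    have h4 : (1 : ℝ) ≤ i := by exact_mod_cast h1
    cases t
    · simp only [this]
      linarith
    · simp only [inner_smul_right, this]
      linarith
  · have e1 := inner_rho_eps_of_pos (n := n) (a := i) (by omega) (by omega)
    have e2 := inner_rho_eps_of_pos (n := n) (a := j) (by omega) (by omega)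
    have h4 : (i : ℝ) < j := by exact_mod_cast h2
    rw [inner_sub_right, e1, e2]
    linarith
  · have e1 := inner_rho_eps_of_pos (n := n) (a := i) (by omega) (by omega)
    have e2 := inner_rho_eps_of_pos (n := n) (a := j) (by omega) (by omega)
    have h4 : (i : ℝ) < j := by exact_mod_cast h2
    have h5 : (1 : ℝ) ≤ i := by exact_mod_cast h1
    rw [inner_add_right, e1, e2]
    linarith

theorem isPosRoot_sub (t : Kind) {n : ℕ} {a b : ℤ} (ha : IsIndex n a)
    (hb : IsIndex n b) (hab : a < b) (hne : a ≠ -b) :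
    IsPosRoot t n (eps n b - eps n a) := by
  right
  rcases le_or_gt 0 a with h3 | h3 <;> rcases le_or_gt 0 b with h5 | h5
  · exact ⟨a, b, by omega, hab, by omega, Or.inl rfl⟩
  · omega
  · rcases lt_or_gt_of_ne hne with h | h
    · refine ⟨b, -a, by omega, by omega, by omega, Or.inr ?_⟩
      rw [eps_neg]
      abel
    · refine ⟨-a, b, by omega, by omega, by omega, Or.inr ?_⟩
      rw [eps_neg]
      abel
  · refine ⟨-b, -a, by omega, by omega, by omega, Or.inl ?_⟩
    rw [eps_neg, eps_neg]
    abel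

theorem isPosRoot_simpleScale_smul_eps (t : Kind) {n : ℕ} {a : ℤ} (ha : 1 ≤ a) (han : a ≤ n) :
    IsPosRoot t n (simpleScale t 1 • eps n a) := by
  left
  refine ⟨a, ha, han, ?_⟩
  cases t <;> simp [simpleScale]

/-- Writing ε_j + ε_i as ε_j - ε_{-i} merges the two families of roots with two nonzero coordinates,
so that later case distinctions have two cases instead of three. -/
theorem IsPosRoot.exists_eps {t : Kind} {n : ℕ} {β : E n} (h : IsPosRoot t n β) :
    (∃ a : ℤ, 1 ≤ a ∧ a ≤ n ∧ β = simpleScale t 1 • eps n a) ∨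
    ∃ a b : ℤ, IsIndex n a ∧ 1 ≤ b ∧ b ≤ n ∧ a < b ∧ a ≠ -b ∧ β = eps n b - eps n a := by
  rcases h with ⟨i, h1, h2, rfl⟩ | ⟨i, j, h1, h2, h3, rfl | rfl⟩
  · left
    refine ⟨i, h1, h2, ?_⟩
    cases t <;> simp [simpleScale]
  · right
    exact ⟨i, j, by omega, by omega, by omega, h2, by omega, rfl⟩
  · right
    refine ⟨-i, j, by omega, by omega, by omega, by omega, by omega, ?_⟩
    rw [eps_neg]
    abel

theorem simpleRoot_of_ne_one (t : Kind) (n : ℕ) {i : ℤ} (hi : i ≠ 1) :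
    simpleRoot t n i = eps n i - eps n (i - 1) := by
  simp [simpleRoot, hi]

theorem simpleRoot_one (t : Kind) (n : ℕ) : simpleRoot t n 1 = simpleScale t 1 • eps n 1 := by
  cases t <;> simp [simpleRoot, simpleScale]

theorem isPosRoot_simpleRoot (t : Kind) {n : ℕ} {i : ℤ} (hi : 1 ≤ i) (hin : i ≤ n) :
    IsPosRoot t n (simpleRoot t n i) := by
  rcases hi.eq_or_lt with rfl | h
  · rw [simpleRoot_one]
    exact isPosRoot_simpleScale_smul_eps t le_rfl hin
  · rw [simpleRoot_of_ne_one t n (by omega)]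
    exact isPosRoot_sub t (by omega) (by omega) (by omega) (by omega)

/-- A simple reflection permutes the positive roots other than its own simple root. -/
theorem IsPosRoot.refl_simpleRoot {t : Kind} {n : ℕ} {β : E n} (h : IsPosRoot t n β) {i : ℤ}
    (hi : 1 ≤ i) (hin : i ≤ n) (hne : β ≠ simpleRoot t n i) :
    IsPosRoot t n (refl (simpleRoot t n i) β) := by
  rcases h.exists_eps with ⟨a, h1, h2, rfl⟩ | ⟨a, b, ha, hb, hbn, hab, hab', rfl⟩
  · rw [map_smul, refl_simpleRoot_eps t hi hin]
    have key : 1 ≤ signedSwap i a ∧ signedSwap i a ≤ n := by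
      by_cases c : i = 1 ∧ a = 1
      · obtain ⟨rfl, rfl⟩ := c
        exact absurd (simpleRoot_one t n).symm hne
      · unfold signedSwap
        split_ifs <;> omega
    exact isPosRoot_simpleScale_smul_eps t key.1 key.2
  · rw [map_sub, refl_simpleRoot_eps t hi hin, refl_simpleRoot_eps t hi hin]
    have k1 := isIndex_signedSwap hi hin ha
    have k2 := isIndex_signedSwap (a := b) hi hin (by omega)
    have key : ¬ (i ≠ 1 ∧ b = i ∧ a = i - 1) := by
      rintro ⟨c1, rfl, rfl⟩
      exact hne (simpleRoot_of_ne_one t n c1).symm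
    refine isPosRoot_sub t k1 k2 ?_ ?_
    · unfold signedSwap
      split_ifs <;> omega
    · unfold signedSwap
      split_ifs <;> omega

/-! ### Words, length and signed permutations. -/

/-- The product of the simple reflections with the indices in a list. -/
noncomputable def wordProd (t : Kind) (n : ℕ) (l : List ℤ) : E n ≃ₗᵢ[ℝ] E n :=
  (l.map fun i => refl (simpleRoot t n i)).prod

theorem wordProd_cons (t : Kind) (n : ℕ) (i : ℤ) (l : List ℤ) :
    wordProd t n (i :: l) = refl (simpleRoot t n i) * wordProd t n l := by
  simp [wordProd]

theorem wordProd_append (t : Kind) (n : ℕ) (l l' : List ℤ) :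
    wordProd t n (l ++ l') = wordProd t n l * wordProd t n l' := by
  simp [wordProd]

theorem refl_inv {n : ℕ} (α : E n) : (refl α)⁻¹ = refl α :=
  inv_eq_of_mul_eq_one_left (refl_mul_self α)

theorem wordProd_reverse (t : Kind) (n : ℕ) (l : List ℤ) :
    wordProd t n l.reverse = (wordProd t n l)⁻¹ := by
  induction l with
  | nil => simp [wordProd]
  | cons i l ih =>
    rw [List.reverse_cons, wordProd_append, ih, wordProd_cons t n i l, mul_inv_rev, refl_inv]
    simp [wordProd]

theorem exists_word {t : Kind} {n : ℕ} {g : E n ≃ₗᵢ[ℝ] E n} (hg : g ∈ weylGroup t n) :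
    ∃ l : List ℤ, (∀ i ∈ l, 1 ≤ i ∧ i ≤ n) ∧ g = wordProd t n l := by
  induction hg using Subgroup.closure_induction with
  | mem x hx =>
    obtain ⟨i, h1, h2, rfl⟩ := hx
    exact ⟨[i], by simpa using ⟨h1, h2⟩, by simp [wordProd]⟩
  | one => exact ⟨[], by simp, by simp [wordProd]⟩
  | mul x y _ _ hx hy =>
    obtain ⟨l, hl, rfl⟩ := hx
    obtain ⟨l', hl', rfl⟩ := hy
    refine ⟨l ++ l', ?_, (wordProd_append t n l l').symm⟩
    intro i hi
    rcases List.mem_append.1 hi with h | h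
    exacts [hl i h, hl' i h]
  | inv x _ hx =>
    obtain ⟨l, hl, rfl⟩ := hx
    exact ⟨l.reverse, fun i hi => hl i (List.mem_reverse.1 hi), (wordProd_reverse t n l).symm⟩

theorem exists_reduced_word {t : Kind} {n : ℕ} (w : weylGroup t n) :
    ∃ l : List ℤ, l.length = coxeterLength w ∧ (∀ i ∈ l, 1 ≤ i ∧ i ≤ n) ∧
      w.1 = wordProd t n l := by
  have hne : {k | ∃ l : List ℤ, l.length = k ∧ (∀ i ∈ l, 1 ≤ i ∧ i ≤ n) ∧
      (w : E n ≃ₗᵢ[ℝ] E n) = (l.map fun i => refl (simpleRoot t n i)).prod}.Nonempty := by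
    obtain ⟨l, hl, h⟩ := exists_word w.2
    exact ⟨l.length, l, rfl, hl, h⟩
  exact Nat.sInf_mem hne

theorem coxeterLength_le {t : Kind} {n : ℕ} (w : weylGroup t n) {l : List ℤ}
    (hl : ∀ i ∈ l, 1 ≤ i ∧ i ≤ n) (h : w.1 = wordProd t n l) : coxeterLength w ≤ l.length :=
  Nat.sInf_le ⟨l, rfl, hl, h⟩

/-- The simple reflection `s_i` as an element of the Weyl group. -/
noncomputable def simpleRefl (t : Kind) {n : ℕ} {i : ℤ} (hi : 1 ≤ i) (hin : i ≤ n) :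
    weylGroup t n :=
  ⟨refl (simpleRoot t n i), Subgroup.subset_closure ⟨i, hi, hin, rfl⟩⟩

/-- Elements of the Weyl group act as signed permutations. -/
theorem exists_signedPerm {t : Kind} {n : ℕ} (v : weylGroup t n) :
    ∃ σ : ℤ → ℤ, ∀ a, IsIndex n a → IsIndex n (σ a) ∧ v.1 (eps n a) = eps n (σ a) := by
  obtain ⟨l, hl, h⟩ := exists_word v.2
  rw [h]
  clear h
  induction l with
  | nil => exact ⟨id, fun a ha => ⟨ha, by simp [wordProd]⟩⟩
  | cons i l ih =>
    obtain ⟨σ, hσ⟩ := ih fun j hj => hl j (List.mem_cons_of_mem _ hj)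
    obtain ⟨h1, h2⟩ := hl i List.mem_cons_self
    refine ⟨fun a => signedSwap i (σ a), fun a ha => ⟨?_, ?_⟩⟩
    · exact isIndex_signedSwap h1 h2 (hσ a ha).1
    · rw [wordProd_cons, LinearIsometryEquiv.coe_mul, Function.comp_apply, (hσ a ha).2,
        refl_simpleRoot_eps t h1 h2]

/-! ### Fundamental weights, the exchange condition and ascents in the Bruhat order. -/

/-- The ratio of `ω_r` to `ε_r + ⋯ + ε_n`. -/
noncomputable def weightScale (t : Kind) (r : ℤ) : ℝ :=
  match t with
  | .B => if r = 1 then 1 / 2 else 1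
  | .C => 1

theorem weightScale_pos (t : Kind) (r : ℤ) : 0 < weightScale t r := by
  cases t
  · simp only [weightScale]
    split_ifs <;> norm_num
  · simp [weightScale]

theorem fundWeight_eq_smul (t : Kind) (n : ℕ) (r : ℤ) :
    fundWeight t n r = weightScale t r • fundWeight .C n r := by
  cases t
  · by_cases h : r = 1 <;> simp [fundWeight, weightScale, h]
  · simp [weightScale]

theorem inner_fundWeight_eps {t : Kind} {n : ℕ} {r a : ℤ} (hr : 1 ≤ r) (ha : IsIndex n a) :
    inner ℝ (fundWeight t n r) (eps n a) =
      if r ≤ a then weightScale t r else if a ≤ -r then -weightScale t r else 0 := by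
  rw [fundWeight_eq_smul, inner_smul_left]
  simp only [fundWeight, conj_trivial]
  rcases le_or_gt 0 a with h | h
  · rw [inner_eps_sum n r a hr (by omega) (by omega)]
    split_ifs <;> first | omega | simp
  · have := inner_eps_sum n r (-a) hr (by omega) (by omega)
    rw [eps_neg, inner_neg_right] at this
    rw [neg_eq_iff_eq_neg.1 this]
    split_ifs <;> first | omega | simp

theorem inner_fundWeight_nonneg {t : Kind} {n : ℕ} {r : ℤ} (hr : 1 ≤ r) {β : E n}
    (h : IsPosRoot t n β) : 0 ≤ inner ℝ (fundWeight t n r) β := by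
  have hw := (weightScale_pos t r).le
  rcases h.exists_eps with ⟨a, h1, h2, rfl⟩ | ⟨a, b, ha, hb, hbn, hab, hab', rfl⟩
  · rw [inner_smul_right, inner_fundWeight_eps hr (by omega)]
    refine mul_nonneg (simpleScale_pos t 1).le ?_
    split_ifs <;> first | omega | linarith
  · rw [inner_sub_right, inner_fundWeight_eps hr (by omega), inner_fundWeight_eps hr (by omega)]
    split_ifs <;> first | omega | linarith

theorem refl_neg {n : ℕ} (α : E n) : refl α (-α) = α := by
  rw [map_neg, refl_apply]
  by_cases h : α = 0
  · simp [h]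
  · have : corootPairing α α = 2 := by
      have : inner ℝ α α ≠ (0 : ℝ) := inner_self_ne_zero.2 h
      unfold corootPairing
      field_simp
    rw [this]
    module

/-- The strong exchange condition, for a root that pairs negatively with a weight `w(ω_r)`. -/
theorem exists_word_refl_mul {t : Kind} {n : ℕ} {r : ℤ} (hr : 1 ≤ r) (l : List ℤ)
    (hl : ∀ i ∈ l, 1 ≤ i ∧ i ≤ n) {β : E n} (hβ : IsPosRoot t n β)
    (hneg : inner ℝ (wordProd t n l (fundWeight t n r)) β < 0) :
    ∃ l' : List ℤ, l'.length < l.length ∧ (∀ i ∈ l', 1 ≤ i ∧ i ≤ n) ∧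
      refl β * wordProd t n l = wordProd t n l' := by
  induction l generalizing β with
  | nil =>
    have : inner ℝ (fundWeight t n r) β < 0 := by simpa [wordProd] using hneg
    exact absurd (inner_fundWeight_nonneg hr hβ) this.not_ge
  | cons i l ih =>
    have hl' : ∀ j ∈ l, 1 ≤ j ∧ j ≤ n := fun j hj => hl j (List.mem_cons_of_mem _ hj)
    obtain ⟨h1, h2⟩ := hl i List.mem_cons_self
    -- Either the first letter is the reflection in β and cancels, or s_i keeps β positive and the
    -- negative pairing moves on to the tail of the word. The empty word cannot be reached, because
    -- ω_r is dominant.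
    by_cases hβi : β = simpleRoot t n i
    · refine ⟨l, by simp, hl', ?_⟩
      rw [hβi, wordProd_cons, ← mul_assoc, refl_mul_self, one_mul]
    · rw [wordProd_cons, LinearIsometryEquiv.coe_mul, Function.comp_apply, inner_refl_left] at hneg
      obtain ⟨l₁, h3, h4, h5⟩ := ih hl' (hβ.refl_simpleRoot h1 h2 hβi) hneg
      refine ⟨i :: l₁, by simpa using h3, ?_, ?_⟩
      · intro j hj
        rcases List.mem_cons.1 hj with rfl | h
        exacts [⟨h1, h2⟩, h4 j h]
      -- The reflection in s_i β is s_i s_β s_i.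
      · rw [wordProd_cons, wordProd_cons, ← h5, refl_map, refl_inv]
        simp only [← mul_assoc, refl_mul_self, one_mul]

theorem coxeterLength_lt {t : Kind} {n : ℕ} {r : ℤ} (hr : 1 ≤ r) {u w : weylGroup t n} {β : E n}
    (hβ : IsPosRoot t n β) (hw : w.1 = refl β * u.1)
    (hneg : inner ℝ (u.1 (fundWeight t n r)) β < 0) : coxeterLength w < coxeterLength u := by
  obtain ⟨l, h1, h2, h3⟩ := exists_reduced_word u
  rw [h3] at hneg hw
  obtain ⟨l', h4, h5, h6⟩ := exists_word_refl_mul hr l h2 hβ hneg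
  rw [h6] at hw
  exact (coxeterLength_le w h5 hw).trans_lt (h1 ▸ h4)

theorem inner_refl_self {n : ℕ} (x α : E n) : inner ℝ (refl α x) α = -inner ℝ x α := by
  have := inner_refl_left α x (-α)
  rw [refl_neg, inner_neg_right] at this
  linarith

theorem BruhatLE.simpleRefl_mul {t : Kind} {n : ℕ} {r : ℤ} (hr : 1 ≤ r) (v : weylGroup t n) {i : ℤ}
    (hi : 1 ≤ i) (hin : i ≤ n)
    (hpos : 0 < inner ℝ (v.1 (fundWeight t n r)) (simpleRoot t n i)) :
    BruhatLE v (simpleRefl t hi hin * v) := by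
  have hβ := isPosRoot_simpleRoot t hi hin
  refine Relation.ReflTransGen.single ⟨simpleRoot t n i, hβ, rfl, ?_⟩
  refine coxeterLength_lt hr hβ (u := simpleRefl t hi hin * v) ?_ ?_
  · change v.1 = refl (simpleRoot t n i) * (refl (simpleRoot t n i) * v.1)
    rw [← mul_assoc, refl_mul_self, one_mul]
  · change inner ℝ (refl (simpleRoot t n i) (v.1 (fundWeight t n r))) (simpleRoot t n i) < 0
    rw [inner_refl_self]
    linarith

theorem inner_simpleRoot_fundWeight_eq_zero {t : Kind} {n : ℕ} {r j : ℤ} (hr : 1 ≤ r) (hrn : r ≤ n)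
    (hj : 1 ≤ j) (hjn : j ≤ n) (hne : j ≠ r) :
    inner ℝ (fundWeight t n r) (simpleRoot t n j) = 0 := by
  rcases hj.eq_or_lt with rfl | h
  · rw [simpleRoot_one, inner_smul_right, inner_fundWeight_eps hr (by omega)]
    split_ifs <;> first | omega | simp
  · rw [simpleRoot_of_ne_one t n (by omega), inner_sub_right, inner_fundWeight_eps hr (by omega),
      inner_fundWeight_eps hr (by omega)]
    split_ifs <;> first | omega | simp

/-- The reflection s_i makes only one positive root negative, namely α_i. If v(α_j) = α_i with j ≠
r, then v(ω_r) would pair with α_i as ω_r does with α_j, that is, to zero. -/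
theorem simpleRefl_mul_mem_minReps {t : Kind} {n : ℕ} {r : ℤ} (hr : 1 ≤ r) (hrn : r ≤ n)
    {v : weylGroup t n} (hv : v ∈ minReps t n r) {i : ℤ} (hi : 1 ≤ i) (hin : i ≤ n)
    (hne : inner ℝ (v.1 (fundWeight t n r)) (simpleRoot t n i) ≠ 0) :
    simpleRefl t hi hin * v ∈ minReps t n r := by
  intro j hj hjn hjr
  change IsPosRoot t n (refl (simpleRoot t n i) (v.1 (simpleRoot t n j)))
  refine (hv j hj hjn hjr).refl_simpleRoot hi hin ?_
  intro h
  rw [← h, LinearIsometryEquiv.inner_map_map] at hne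
  exact hne (inner_simpleRoot_fundWeight_eq_zero hr hrn hj hjn hjr)

/-! ### Coefficients in the simple roots, and their monotonicity along the Bruhat order. -/

/-- The simple roots of type B and the fundamental weights of type C are dual bases for the standard
inner product. Pairing with the latter thus extracts coefficients, in both types up to the factor
`simpleScale`. -/
theorem inner_simpleRoot_fundWeight {n : ℕ} {i j : ℤ} (hi : 1 ≤ i) (hin : i ≤ n) (hj : 1 ≤ j) :
    inner ℝ (simpleRoot .B n i) (fundWeight .C n j) = if i = j then (1 : ℝ) else 0 := by
  rw [real_inner_comm]
  rcases hi.eq_or_lt with rfl | h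
  · rw [simpleRoot_one, inner_smul_right, inner_fundWeight_eps hj (by omega)]
    simp only [simpleScale, weightScale]
    split_ifs <;> first | omega | simp
  · rw [simpleRoot_of_ne_one .B n (by omega), inner_sub_right, inner_fundWeight_eps hj (by omega),
      inner_fundWeight_eps hj (by omega)]
    simp only [weightScale]
    split_ifs <;> first | omega | simp

theorem fundWeight_sub_fundWeight (n : ℕ) {i : ℤ} (hin : i ≤ n) :
    fundWeight .C n i - fundWeight .C n (i + 1) = eps n i := by
  have : Finset.Icc i (n : ℤ) = insert i (Finset.Icc (i + 1) (n : ℤ)) := by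
    ext a
    simp only [Finset.mem_Icc, Finset.mem_insert]
    omega
  simp only [fundWeight]
  rw [this, Finset.sum_insert (by simp)]
  abel

theorem fundWeight_of_lt (n : ℕ) {i : ℤ} (hin : (n : ℤ) < i) : fundWeight .C n i = 0 := by
  simp only [fundWeight]
  rw [Finset.Icc_eq_empty (by omega), Finset.sum_empty]

theorem ext_inner_fundWeight {n : ℕ} {x y : E n}
    (h : ∀ i : ℤ, 1 ≤ i → i ≤ n →
      inner ℝ x (fundWeight .C n i) = inner ℝ y (fundWeight .C n i)) : x = y := by
  have h' : ∀ i : ℤ, 1 ≤ i → inner ℝ x (fundWeight .C n i) = inner ℝ y (fundWeight .C n i) := by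
    intro i hi
    by_cases hin : i ≤ n
    · exact h i hi hin
    · rw [fundWeight_of_lt n (by omega), inner_zero_right, inner_zero_right]
  refine ext_inner_eps fun a ha han => ?_
  rw [← fundWeight_sub_fundWeight n han, inner_sub_right, inner_sub_right, h' a ha,
    h' (a + 1) (by omega)]

theorem inner_sum_simpleRoot {n : ℕ} {ι : ℤ → ℝ} {T : Finset ℤ} (hT : ∀ i ∈ T, 1 ≤ i ∧ i ≤ n) {j : ℤ}
    (hj : 1 ≤ j) : inner ℝ (∑ i ∈ T, ι i • simpleRoot .B n i) (fundWeight .C n j) =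
      if j ∈ T then ι j else 0 := by
  rw [sum_inner, ← Finset.sum_ite_eq' T j ι]
  refine Finset.sum_congr rfl fun i hi => ?_
  rw [inner_smul_left, inner_simpleRoot_fundWeight (hT i hi).1 (hT i hi).2 hj]
  simp

theorem nonnegWeight_iff {t : Kind} {n : ℕ} {x : E n} :
    NonnegWeight t n x ↔ ∀ i : ℤ, 1 ≤ i → i ≤ n → 0 ≤ inner ℝ x (fundWeight .C n i) := by
  have hT : ∀ i ∈ Finset.Icc (1 : ℤ) n, 1 ≤ i ∧ i ≤ n := fun i hi => Finset.mem_Icc.1 hi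
  have hc : ∀ c : ℤ → ℝ, ∑ j ∈ Finset.Icc (1 : ℤ) n, c j • simpleRoot t n j =
      ∑ j ∈ Finset.Icc (1 : ℤ) n, (c j * simpleScale t j) • simpleRoot .B n j := by
    intro c
    refine Finset.sum_congr rfl fun i _ => ?_
    rw [simpleRoot_eq_smul, smul_smul]
  constructor
  · rintro ⟨c, h0, rfl⟩ i hi hin
    rw [hc, inner_sum_simpleRoot hT hi, if_pos (Finset.mem_Icc.2 ⟨hi, hin⟩)]
    exact mul_nonneg (h0 i) (simpleScale_pos t i).le
  · intro h
    -- The coefficients must be nonnegative at all integers, so they are set to 0 outside [1,n],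
    -- where the pairing gives no control.
    refine ⟨fun i => if 1 ≤ i ∧ i ≤ n then
      inner ℝ x (fundWeight .C n i) / simpleScale t i else 0, ?_, ?_⟩
    · intro i
      dsimp only
      split_ifs with hi
      · exact div_nonneg (h i hi.1 hi.2) (simpleScale_pos t i).le
      · exact le_rfl
    · refine ext_inner_fundWeight fun i hi hin => ?_
      rw [hc, inner_sum_simpleRoot hT hi, if_pos (Finset.mem_Icc.2 ⟨hi, hin⟩), if_pos ⟨hi, hin⟩,
        div_mul_cancel₀ _ (simpleScale_pos t i).ne']

/-- A step upwards subtracts a nonnegative multiple of a positive root from the weight, and a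
positive root pairs nonnegatively with every ω_i. -/
theorem BruhatStep.inner_le {t : Kind} {n : ℕ} {r : ℤ} (hr : 1 ≤ r) {u w : weylGroup t n}
    (h : BruhatStep u w) {i : ℤ} (hi : 1 ≤ i) :
    inner ℝ (w.1 (fundWeight t n r)) (fundWeight .C n i) ≤
      inner ℝ (u.1 (fundWeight t n r)) (fundWeight .C n i) := by
  obtain ⟨β, hβ, hw, hlt⟩ := h
  -- A negative pairing would make s_β u shorter than u, by the exchange condition.
  have h1 : 0 ≤ inner ℝ (u.1 (fundWeight t n r)) β := by
    by_contra hneg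
    exact absurd (coxeterLength_lt hr hβ hw (not_le.1 hneg)) hlt.not_gt
  have h2 : 0 ≤ inner ℝ β (fundWeight .C n i) := by
    rw [real_inner_comm]
    rcases hβ.exists_eps with ⟨a, h1, h2, rfl⟩ | ⟨a, b, ha, hb, hbn, hab, hab', rfl⟩
    · rw [inner_smul_right]
      refine mul_nonneg (simpleScale_pos t 1).le ?_
      rw [inner_fundWeight_eps hi (by omega)]
      simp only [weightScale]
      split_ifs <;> first | omega | norm_num
    · exact inner_fundWeight_nonneg hi (isPosRoot_sub .C ha (by omega) hab hab')
  have h3 : w.1 (fundWeight t n r) = refl β (u.1 (fundWeight t n r)) := by rw [hw]; rfl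
  rw [h3, refl_apply, inner_sub_left, inner_smul_left, conj_trivial]
  have : 0 ≤ corootPairing (u.1 (fundWeight t n r)) β := by
    unfold corootPairing
    exact div_nonneg (by linarith) real_inner_self_nonneg
  nlinarith [mul_nonneg this h2]

theorem BruhatLE.inner_le {t : Kind} {n : ℕ} {r : ℤ} (hr : 1 ≤ r) {u w : weylGroup t n}
    (h : BruhatLE u w) {i : ℤ} (hi : 1 ≤ i) :
    inner ℝ (w.1 (fundWeight t n r)) (fundWeight .C n i) ≤
      inner ℝ (u.1 (fundWeight t n r)) (fundWeight .C n i) := by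
  induction h with
  | refl => exact le_rfl
  | tail _ hstep ih => exact (hstep.inner_le hr hi).trans ih

theorem eq_of_pairwise_lt {l l' : List ℤ} (h : l.Pairwise (· < ·)) (h' : l'.Pairwise (· < ·))
    (hmem : ∀ a, a ∈ l ↔ a ∈ l') : l = l' :=
  ((List.perm_ext_iff_of_nodup (h.imp ne_of_lt) (h'.imp ne_of_lt)).2 hmem).eq_of_pairwise
    (fun _ _ _ _ h1 h2 => absurd h1 h2.not_gt) h h'

/-! ### Integer walks that cannot be lowered. -/

/-- A walk with steps in `{-1, 0, 1}`, read from right to left. -/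
structure IsWalk (n : ℕ) (c : ℤ → ℤ) : Prop where
  le : ∀ j : ℤ, 1 ≤ j → j ≤ n → c j ≤ c (j + 1) + 1
  ge : ∀ j : ℤ, 1 ≤ j → j ≤ n → c (j + 1) ≤ c j + 1
  last : c (n + 1) = 0

/-- The walk `c` either vanishes at `i` or has an isolated peak of height one there. -/
def IsFlatAt (c : ℤ → ℤ) (i : ℤ) : Prop :=
  c i = 0 ∨ c i = 1 ∧ c (i + 1) = 0 ∧ (i = 1 ∨ c (i - 1) = 0)

/-- The hypotheses `h1` and `h2` say that lowering c_1 to 2c_2 - c_1, or c_i to c_{i+1} + c_{i-1} -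
c_i, always leaves the nonnegative range. The induction goes to the right because flatness at j
excludes two descents in a row. -/
theorem IsWalk.isFlatAt_of_descent {n : ℕ} {c : ℤ → ℤ} (hc : IsWalk n c)
    (h0 : ∀ i : ℤ, 1 ≤ i → i ≤ n + 1 → 0 ≤ c i)
    (h1 : ¬ (c 2 < c 1 ∧ 0 ≤ 2 * c 2 - c 1))
    (h2 : ∀ i : ℤ, 2 ≤ i → i ≤ n →
      ¬ (c (i + 1) + c (i - 1) < 2 * c i ∧ 0 ≤ c (i + 1) + c (i - 1) - c i))
    (j : ℕ) : 1 ≤ j → j ≤ n → c (j + 1) < c j → IsFlatAt c j := by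
  induction j with
  | zero => omega
  | succ j ih =>
    intro _ hjn hlt
    have a1 := hc.le (j + 1) (by omega) (by omega)
    have a0 := h0 (j + 1 + 1) (by omega) (by omega)
    push_cast at hlt ⊢
    rcases Nat.eq_zero_or_pos j with rfl | hj
    · norm_num at *
      unfold IsFlatAt
      norm_num
      omega
    · have b := h2 (j + 1) (by omega) (by omega)
      have a2 := hc.ge j (by omega) (by omega)
      have a3 := h0 j (by omega) (by omega)
      have e : (j : ℤ) + 1 - 1 = j := by ring
      rw [e] at b
      unfold IsFlatAt
      rw [e]
      -- Two successive descents would start at height at least 2, against flatness at j. Otherwise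
      -- j + 1 is a strict local maximum in the sense of `h2`, which forces c_j = 0 and then c_{j+1}
      -- = 1.
      by_cases hlt' : c (j + 1) < c j
      · have := ih hj (by omega) hlt'
        unfold IsFlatAt at this
        omega
      · omega

/-- A nonnegative walk that no simple reflection can lower further has only isolated peaks of
height one. -/
theorem IsWalk.isFlatAt {n : ℕ} {c : ℤ → ℤ} (hc : IsWalk n c)
    (h0 : ∀ i : ℤ, 1 ≤ i → i ≤ n + 1 → 0 ≤ c i)
    (h1 : ¬ (c 2 < c 1 ∧ 0 ≤ 2 * c 2 - c 1))
    (h2 : ∀ i : ℤ, 2 ≤ i → i ≤ n →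
      ¬ (c (i + 1) + c (i - 1) < 2 * c i ∧ 0 ≤ c (i + 1) + c (i - 1) - c i))
    {i : ℤ} (hi : 1 ≤ i) (hin : i ≤ n) : IsFlatAt c i := by
  obtain ⟨d, hd⟩ : ∃ d : ℕ, (n : ℤ) - i = d := ⟨((n : ℤ) - i).toNat, by omega⟩
  have key := fun j => hc.isFlatAt_of_descent h0 h1 h2 j
  induction d generalizing i with
  | zero =>
    have hl := hc.last
    by_cases h : c i = 0
    · exact Or.inl h
    · have := key n (by omega) le_rfl
      have e : i = n := by omega
      subst e
      have := h0 n (by omega) (by omega)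
      exact key n (by omega) le_rfl (by omega)
  | succ d ih =>
    -- Flatness at i + 1 gives c_{i+1} = 0 or c_i = 0, so a nonzero c_i is the start of a descent.
    have h3 := ih (i := i + 1) (by omega) (by omega) (by omega)
    by_cases h : c i = 0
    · exact Or.inl h
    · have a0 := h0 i (by omega) (by omega)
      have e : i + 1 - 1 = i := by ring
      unfold IsFlatAt at h3
      rw [e] at h3
      obtain ⟨k, rfl⟩ : ∃ k : ℕ, i = k := ⟨i.toNat, by omega⟩
      exact key k (by omega) (by omega) (by omega)

/-! ### Vectors with coordinates 0 and ±κ, and their walks. -/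

/-- All coordinates of `x` lie in `{0, κ, -κ}`. -/
def HasSignCoords {n : ℕ} (κ : ℝ) (x : E n) : Prop :=
  ∀ a : ℤ, IsIndex n a → inner ℝ x (eps n a) = κ ∨ inner ℝ x (eps n a) = 0 ∨
    inner ℝ x (eps n a) = -κ

theorem apply_inv_apply {n : ℕ} (g : E n ≃ₗᵢ[ℝ] E n) (x : E n) : g (g⁻¹ x) = x :=
  g.apply_symm_apply x

theorem inner_apply_left {n : ℕ} (g : E n ≃ₗᵢ[ℝ] E n) (x y : E n) :
    inner ℝ (g x) y = inner ℝ x (g⁻¹ y) := by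
  conv_lhs => rw [← apply_inv_apply g y]
  exact g.inner_map_map x _

theorem hasSignCoords_apply_fundWeight {t : Kind} {n : ℕ} {r : ℤ} (hr : 1 ≤ r)
    (v : weylGroup t n) : HasSignCoords (weightScale t r) (v.1 (fundWeight t n r)) := by
  intro a ha
  obtain ⟨σ, hσ⟩ := exists_signedPerm v⁻¹
  have h : v.1⁻¹ (eps n a) = eps n (σ a) := (hσ a ha).2
  rw [inner_apply_left, h, inner_fundWeight_eps hr (hσ a ha).1]
  split_ifs
  exacts [Or.inl rfl, Or.inr (Or.inr rfl), Or.inr (Or.inl rfl)]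

/-- The walk consists of the tail sums of the coordinates divided by κ. The alternative j < 1 is
there because the increments outside [1,n] are arbitrary; beyond n both sides are empty sums. -/
theorem HasSignCoords.exists_walk {n : ℕ} {κ : ℝ} {x : E n} (hx : HasSignCoords κ x) :
    ∃ c : ℤ → ℤ, IsWalk n c ∧ ∀ j : ℤ, inner ℝ x (fundWeight .C n j) = κ * c j ∨ j < 1 := by
  have h : ∀ a : ℤ, ∃ g : ℤ, (-1 ≤ g ∧ g ≤ 1) ∧
      (1 ≤ a → a ≤ n → inner ℝ x (eps n a) = κ * g) := by
    intro a
    by_cases ha : 1 ≤ a ∧ a ≤ n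
    · rcases hx a (by omega) with h | h | h
      · exact ⟨1, by norm_num, fun _ _ => by simp [h]⟩
      · exact ⟨0, by norm_num, fun _ _ => by simp [h]⟩
      · exact ⟨-1, by norm_num, fun _ _ => by simp [h]⟩
    · exact ⟨0, by norm_num, fun h1 h2 => absurd ⟨h1, h2⟩ ha⟩
  choose g hg hg' using h
  have hstep : ∀ j : ℤ, j ≤ n →
      ∑ k ∈ Finset.Icc j (n : ℤ), g k = g j + ∑ k ∈ Finset.Icc (j + 1) (n : ℤ), g k := by
    intro j hj
    have : Finset.Icc j (n : ℤ) = insert j (Finset.Icc (j + 1) (n : ℤ)) := by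
      ext a
      simp only [Finset.mem_Icc, Finset.mem_insert]
      omega
    rw [this, Finset.sum_insert (by simp)]
  refine ⟨fun j => ∑ k ∈ Finset.Icc j (n : ℤ), g k, ⟨?_, ?_, ?_⟩, ?_⟩
  · intro j _ hj
    have := hstep j hj
    have := hg j
    omega
  · intro j _ hj
    have := hstep j hj
    have := hg j
    omega
  · rw [Finset.Icc_eq_empty (by omega), Finset.sum_empty]
  · intro j
    by_cases hj : j < 1
    · exact Or.inr hj
    · left
      simp only [fundWeight]
      rw [inner_sum, Int.cast_sum, Finset.mul_sum]
      refine Finset.sum_congr rfl fun k hk => ?_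
      rw [Finset.mem_Icc] at hk
      exact hg' k (by omega) hk.2

/-! ### Reconstructing an element of W^{I_r} from its weight. -/

section Windows

variable {t : Kind} {n r : ℕ}

theorem ext_of_eps {u v : weylGroup t n}
    (h : ∀ a : ℤ, 1 ≤ a → a ≤ n → u.1 (eps n a) = v.1 (eps n a)) : u = v := by
  -- For isometries the inverse is the adjoint, so agreement on the basis determines all coordinates
  -- of the inverses.
  have : u.1⁻¹ = v.1⁻¹ := by
    ext1 z
    refine ext_inner_eps fun a ha han => ?_
    rw [inner_apply_left, inner_apply_left, inv_inv, inv_inv, h a ha han]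
  exact Subtype.ext (inv_injective this)

/-- The window of `v ∈ W^{I_r}` lists, in increasing order, first the zero coordinates of
`v(ω_r)` and then its nonzero coordinates with their signs. -/
theorem isWindow_append (hr : 1 ≤ r) (hrn : r ≤ n) {v : weylGroup t n}
    (hv : v ∈ minReps t n r) {l l' : List ℤ} (hl : l.Pairwise (· < ·)) (hl' : l'.Pairwise (· < ·))
    (hmem : ∀ a, a ∈ l ↔ 1 ≤ a ∧ a ≤ n ∧ inner ℝ (v.1 (fundWeight t n r)) (eps n a) = 0)
    (hmem' : ∀ a, a ∈ l' ↔ IsIndex n a ∧ 0 < inner ℝ (v.1 (fundWeight t n r)) (eps n a)) :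
    IsWindow v (l ++ l') := by
  obtain ⟨σ, hσ⟩ := exists_signedPerm v
  obtain ⟨τ, hτ⟩ := exists_signedPerm v⁻¹
  have hκ := weightScale_pos t r
  have hr' : (1 : ℤ) ≤ r := by exact_mod_cast hr
  have hστ : ∀ a, IsIndex n a → σ (τ a) = a := by
    intro a ha
    have h1 : v.1⁻¹ (eps n a) = eps n (τ a) := (hτ a ha).2
    have h2 := (hσ (τ a) (hτ a ha).1).2
    rw [← h1, apply_inv_apply] at h2
    exact (eps_injective ha h2).symm
  have hcoord : ∀ k, IsIndex n k → inner ℝ (v.1 (fundWeight t n r)) (eps n (σ k)) =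
      inner ℝ (fundWeight t n r) (eps n k) := by
    intro k hk
    rw [← (hσ k hk).2, LinearIsometryEquiv.inner_map_map]
  have hstep : ∀ j : ℤ, 2 ≤ j → j ≤ n → j ≠ r → σ (j - 1) < σ j := by
    intro j hj hjn hjr
    have h := (hv j (by omega) hjn hjr).inner_rho_pos
    have i1 := hσ j (by omega)
    have i2 := hσ (j - 1) (by omega)
    rw [simpleRoot_of_ne_one t n (by omega), map_sub, i1.2, i2.2, inner_sub_right,
      inner_rho_eps i1.1, inner_rho_eps i2.1] at h
    have : (σ (j - 1) : ℝ) < σ j := by linarith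
    exact_mod_cast this
  have hfirst : r ≠ 1 → 0 < σ 1 := by
    intro hr1
    have h := (hv 1 le_rfl (by omega) (by omega)).inner_rho_pos
    have i1 := hσ 1 (by omega)
    rw [simpleRoot_one, map_smul, i1.2, inner_smul_right, inner_rho_eps i1.1] at h
    exact_mod_cast (mul_pos_iff_of_pos_left (simpleScale_pos t 1)).1 h
  -- Monotonicity holds on [1, r-1] and on [r, n] separately: the missing condition at α_r is
  -- exactly the break between the two blocks.
  have hmono : ∀ (j : ℤ) (d : ℕ), 1 ≤ j → j + d + 1 ≤ n → (j + d + 1 < r ∨ r ≤ j) →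
      σ j < σ (j + d + 1) := by
    intro j d hj hn hjr
    induction d with
    | zero =>
      have := hstep (j + 1) (by omega) (by push_cast at hn; omega) (by push_cast at hjr; omega)
      have e : j + 1 - 1 = j := by ring
      rw [e] at this
      simpa using this
    | succ d ih =>
      push_cast at hn hjr ⊢
      have h1 := ih (by omega) (by omega)
      have h2 := hstep (j + (d + 1) + 1) (by omega) (by omega) (by omega)
      have e : j + ((d : ℤ) + 1) + 1 - 1 = j + d + 1 := by ring
      rw [e] at h2
      exact h1.trans h2
  have hmono' : ∀ j k : ℤ, 1 ≤ j → j < k → k ≤ n → (k < r ∨ r ≤ j) → σ j < σ k := by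
    intro j k h1 h2 h3 h4
    have e : j + ((k - j - 1).toNat : ℤ) + 1 = k := by omega
    have := hmono j (k - j - 1).toNat h1 (by omega) (by omega)
    rwa [e] at this
  have hA : l = (List.range (r - 1)).map fun k : ℕ => σ ((k : ℤ) + 1) := by
    refine eq_of_pairwise_lt hl ?_ ?_
    · rw [List.pairwise_map]
      refine List.Pairwise.imp_of_mem ?_ List.pairwise_lt_range
      intro a b ha hb hab
      rw [List.mem_range] at ha hb
      exact hmono' _ _ (by omega) (by omega) (by omega) (by omega)
    · intro a
      rw [hmem, List.mem_map]
      constructor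
      · rintro ⟨h1, h2, h3⟩
        have ia : IsIndex n a := by omega
        have ib := (hτ a ia).1
        rw [← hστ a ia, hcoord _ ib, inner_fundWeight_eps hr' ib] at h3
        split_ifs at h3 with h4 h5
        · linarith
        · linarith
        -- A negative preimage of a would give σ(-τ a) = -a < 0, whereas σ is positive on [1, r-1],
        -- being increasing there with σ(1) > 0.
        · have hpos : 0 < τ a := by
            by_contra hneg
            have h6 : 0 < σ (-τ a) := by
              have h7 := hfirst (by omega)
              rcases eq_or_ne (-τ a) 1 with h8 | h8
              · rwa [h8]
              · exact h7.trans (hmono' 1 (-τ a) le_rfl (by omega) (by omega) (by omega))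
            have h9 : eps n (σ (-τ a)) = eps n (-σ (τ a)) := by
              rw [← (hσ (-τ a) (by omega)).2, eps_neg, eps_neg, map_neg, (hσ (τ a) ib).2]
            have h10 := eps_injective (hσ (-τ a) (by omega)).1 h9
            rw [hστ a ia] at h10
            omega
          refine ⟨(τ a - 1).toNat, List.mem_range.2 (by omega), ?_⟩
          have e : ((τ a - 1).toNat : ℤ) + 1 = τ a := by omega
          rw [e, hστ a ia]
      · rintro ⟨k, hk, rfl⟩
        rw [List.mem_range] at hk
        have ik : IsIndex n ((k : ℤ) + 1) := by omega
        have h1 := hfirst (by omega)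
        refine ⟨?_, (hσ _ ik).1.2.2, ?_⟩
        · rcases Nat.eq_zero_or_pos k with rfl | h2
          · simp only [Nat.cast_zero, zero_add]
            omega
          · have := hmono' 1 (k + 1) le_rfl (by omega) (by omega) (by omega)
            omega
        · rw [hcoord _ ik, inner_fundWeight_eps hr' ik, if_neg (by omega), if_neg (by omega)]
  have hB : l' = (List.range (n + 1 - r)).map fun k : ℕ => σ ((k : ℤ) + r) := by
    refine eq_of_pairwise_lt hl' ?_ ?_
    · rw [List.pairwise_map]
      refine List.Pairwise.imp_of_mem ?_ List.pairwise_lt_range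
      intro a b ha hb hab
      rw [List.mem_range] at ha hb
      exact hmono' _ _ (by omega) (by omega) (by omega) (by omega)
    · intro a
      rw [hmem', List.mem_map]
      constructor
      · rintro ⟨ia, h3⟩
        have ib := (hτ a ia).1
        rw [← hστ a ia, hcoord _ ib, inner_fundWeight_eps hr' ib] at h3
        split_ifs at h3 with h4 h5
        · refine ⟨(τ a - r).toNat, List.mem_range.2 (by omega), ?_⟩
          have e : ((τ a - r).toNat : ℤ) + r = τ a := by omega
          rw [e, hστ a ia]
        · linarith
        · linarith
      · rintro ⟨k, hk, rfl⟩
        rw [List.mem_range] at hk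
        have ik : IsIndex n ((k : ℤ) + r) := by omega
        refine ⟨(hσ _ ik).1, ?_⟩
        rw [hcoord _ ik, inner_fundWeight_eps hr' ik, if_pos (by omega)]
        exact hκ
  refine ⟨by rw [hA, hB]; simp; omega, fun k hk => ?_⟩
  subst hA hB
  simp only [List.length_append, List.length_map, List.length_range] at hk
  rw [(hσ _ (by omega)).2]
  congr 1
  by_cases hkr : k < r - 1
  · rw [List.getElem_append_left (by simpa using hkr)]
    simp
  · rw [List.getElem_append_right (by simpa using hkr)]
    simp only [List.length_map, List.length_range, List.getElem_map, List.getElem_range]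
    congr 1
    omega

/-- An element of `W^{I_r}` is determined by its action on `ω_r`. -/
theorem minReps_ext (hr : 1 ≤ r) (hrn : r ≤ n) {u v : weylGroup t n} (hu : u ∈ minReps t n r)
    (hv : v ∈ minReps t n r) (h : u.1 (fundWeight t n r) = v.1 (fundWeight t n r)) : u = v := by
  classical
  let l := ((Finset.Icc (1 : ℤ) n).filter fun a =>
    inner ℝ (v.1 (fundWeight t n r)) (eps n a) = 0).sort (· ≤ ·)
  let l' := ((Finset.Icc (-n : ℤ) n).filter fun a =>
    a ≠ 0 ∧ 0 < inner ℝ (v.1 (fundWeight t n r)) (eps n a)).sort (· ≤ ·)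
  have hl : l.Pairwise (· < ·) := (Finset.sortedLT_sort _).pairwise
  have hl' : l'.Pairwise (· < ·) := (Finset.sortedLT_sort _).pairwise
  have hm : ∀ a, a ∈ l ↔ 1 ≤ a ∧ a ≤ n ∧ inner ℝ (v.1 (fundWeight t n r)) (eps n a) = 0 := by
    intro a
    simp only [l, Finset.mem_sort, Finset.mem_filter, Finset.mem_Icc, and_assoc]
  have hm' : ∀ a, a ∈ l' ↔ IsIndex n a ∧ 0 < inner ℝ (v.1 (fundWeight t n r)) (eps n a) := by
    intro a
    simp only [l', Finset.mem_sort, Finset.mem_filter, Finset.mem_Icc, IsIndex]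
    tauto
  have w1 := isWindow_append hr hrn hv hl hl' hm hm'
  have w2 := isWindow_append hr hrn hu hl hl' (by rwa [h]) (by rwa [h])
  refine ext_of_eps fun a ha han => ?_
  have hlen := w1.1
  have e : (((a - 1).toNat : ℕ) : ℤ) + 1 = a := by omega
  have e1 := w1.2 (a - 1).toNat (by omega)
  have e2 := w2.2 (a - 1).toNat (by omega)
  rw [e] at e1 e2
  rw [e1, e2]

end Windows

/-! ### The orbit of ω_r. -/

theorem inner_simpleRoot_rho {n : ℕ} {i : ℤ} (hi : 1 ≤ i) (hin : i ≤ n) :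
    inner ℝ (rho n) (simpleRoot .B n i) = 1 := by
  rcases hi.eq_or_lt with rfl | h
  · rw [simpleRoot_one, inner_smul_right, inner_rho_eps_of_pos le_rfl hin]
    simp [simpleScale]
  · rw [simpleRoot_of_ne_one .B n (by omega), inner_sub_right,
      inner_rho_eps_of_pos (by omega) hin, inner_rho_eps_of_pos (by omega) (by omega)]
    simp

theorem corootPairing_simpleRoot_one {n : ℕ} (hn : 1 ≤ n) (x : E n) :
    corootPairing x (simpleRoot .B n 1) = 2 * inner ℝ x (eps n 1) := by
  have h := inner_eps n 1 1 le_rfl (by omega) le_rfl (by omega)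
  rw [if_pos rfl] at h
  rw [simpleRoot_one]
  simp only [simpleScale, one_smul, corootPairing]
  rw [h, div_one]

theorem corootPairing_simpleRoot {n : ℕ} {i : ℤ} (hi : 2 ≤ i) (hin : i ≤ n) (x : E n) :
    corootPairing x (simpleRoot .B n i) = inner ℝ x (eps n i) - inner ℝ x (eps n (i - 1)) := by
  have e1 := inner_eps n i i (by omega) (by omega) (by omega) (by omega)
  have e2 := inner_eps n (i - 1) (i - 1) (by omega) (by omega) (by omega) (by omega)
  have e3 := inner_eps n i (i - 1) (by omega) (by omega) (by omega) (by omega)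
  have e4 := inner_eps n (i - 1) i (by omega) (by omega) (by omega) (by omega)
  rw [if_pos rfl] at e1 e2
  rw [if_neg (by omega)] at e3 e4
  rw [simpleRoot_of_ne_one .B n (by omega)]
  simp only [corootPairing, inner_sub_left, inner_sub_right, e1, e2, e3, e4]
  ring

theorem simpleRoot_ne_zero {n : ℕ} {i : ℤ} (hi : 1 ≤ i) (hin : i ≤ n) : simpleRoot .B n i ≠ 0 := by
  intro h
  have := inner_simpleRoot_rho hi hin
  rw [h, inner_zero_right] at this
  norm_num at this

theorem corootPairing_neg_iff {n : ℕ} {i : ℤ} (hi : 1 ≤ i) (hin : i ≤ n) (x : E n) :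
    corootPairing x (simpleRoot .B n i) < 0 ↔ inner ℝ x (simpleRoot .B n i) < 0 := by
  have := real_inner_self_pos.2 (simpleRoot_ne_zero hi hin)
  unfold corootPairing
  rw [div_neg_iff]
  constructor
  · rintro (⟨_, h⟩ | ⟨h, _⟩) <;> linarith
  · intro h
    right
    constructor <;> linarith

theorem HasSignCoords.refl_simpleRoot {n : ℕ} {κ : ℝ} {x : E n} (hx : HasSignCoords κ x) {i : ℤ}
    (hi : 1 ≤ i) (hin : i ≤ n) : HasSignCoords κ (refl (simpleRoot .B n i) x) := by
  intro a ha
  rw [inner_refl_left, refl_simpleRoot_eps .B hi hin]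
  exact hx _ (isIndex_signedSwap hi hin ha)

/-- All these pairings are integer multiples of κ: twice a coordinate for i = 1, a difference of two
coordinates otherwise. The uniform gap makes the descent in `exists_minReps` terminate. -/
theorem HasSignCoords.corootPairing_le {n : ℕ} {κ : ℝ} (hκ : 0 < κ) {x : E n}
    (hx : HasSignCoords κ x) {i : ℤ} (hi : 1 ≤ i) (hin : i ≤ n)
    (hneg : inner ℝ x (simpleRoot .B n i) < 0) :
    corootPairing x (simpleRoot .B n i) ≤ -κ := by
  have h := (corootPairing_neg_iff hi hin x).2 hneg
  rcases hi.eq_or_lt with rfl | h2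
  · rw [corootPairing_simpleRoot_one (by omega)] at h ⊢
    rcases hx 1 (by omega) with h3 | h3 | h3 <;> rw [h3] at h ⊢ <;> linarith
  · rw [corootPairing_simpleRoot h2 hin] at h ⊢
    rcases hx i (by omega) with h3 | h3 | h3 <;>
      rcases hx (i - 1) (by omega) with h4 | h4 | h4 <;> rw [h3, h4] at h ⊢ <;> linarith

theorem HasSignCoords.inner_rho_le {n : ℕ} {κ : ℝ} (hκ : 0 < κ) {x : E n}
    (hx : HasSignCoords κ x) :
    inner ℝ x (rho n) ≤ κ * ∑ k ∈ Finset.Icc (1 : ℤ) n, (k : ℝ) := by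
  rw [rho, inner_sum, Finset.mul_sum]
  refine Finset.sum_le_sum fun k hk => ?_
  rw [Finset.mem_Icc] at hk
  have h1 : (1 : ℝ) ≤ k := by exact_mod_cast hk.1
  rw [inner_smul_right]
  rcases hx k (by omega) with h | h | h <;> rw [h] <;> nlinarith

/-- A dominant vector with coordinates in `{0, κ, -κ}` is determined by its length. -/
theorem HasSignCoords.eq_fundWeight {t : Kind} {n : ℕ} {r : ℤ} (hr : 1 ≤ r) {x : E n}
    (hx : HasSignCoords (weightScale t r) x)
    (hnorm : inner ℝ x x = inner ℝ (fundWeight t n r) (fundWeight t n r))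
    (hdom : ∀ i : ℤ, 1 ≤ i → i ≤ n → 0 ≤ inner ℝ x (simpleRoot .B n i)) :
    x = fundWeight t n r := by
  have hκ := weightScale_pos t r
  have hstep : ∀ i : ℤ, 2 ≤ i → i ≤ n → inner ℝ x (eps n (i - 1)) ≤ inner ℝ x (eps n i) := by
    intro i hi hin
    have := hdom i (by omega) hin
    rw [simpleRoot_of_ne_one .B n (by omega), inner_sub_right] at this
    linarith
  have hmono : ∀ (i : ℤ) (d : ℕ), 1 ≤ i → i + d ≤ n →
      inner ℝ x (eps n i) ≤ inner ℝ x (eps n (i + d)) := by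
    intro i d hi hd
    induction d with
    | zero => simp
    | succ d ih =>
      push_cast at hd ⊢
      have h1 := hstep (i + (d + 1)) (by omega) hd
      have e : i + ((d : ℤ) + 1) - 1 = i + d := by ring
      rw [e] at h1
      exact (ih (by omega)).trans h1
  have hmono' : ∀ i j : ℤ, 1 ≤ i → i ≤ j → j ≤ n →
      inner ℝ x (eps n i) ≤ inner ℝ x (eps n j) := by
    intro i j h1 h2 h3
    have e : i + ((j - i).toNat : ℤ) = j := by omega
    have := hmono i (j - i).toNat h1 (by omega)
    rwa [e] at this
  have hnn : ∀ i : ℤ, 1 ≤ i → i ≤ n → 0 ≤ inner ℝ x (eps n i) := by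
    intro i hi hin
    have h1 := hdom 1 le_rfl (by omega)
    rw [simpleRoot_one, inner_smul_right] at h1
    simp only [simpleScale, one_mul] at h1
    exact h1.trans (hmono' 1 i le_rfl hi hin)
  have hcoord : ∀ i : ℤ, 1 ≤ i → i ≤ n →
      inner ℝ x (eps n i) = weightScale t r ∨ inner ℝ x (eps n i) = 0 := by
    intro i hi hin
    rcases hx i (by omega) with h | h | h
    · exact Or.inl h
    · exact Or.inr h
    · have := hnn i hi hin
      linarith
  have hω : ∀ i : ℤ, 1 ≤ i → i ≤ n →
      inner ℝ (fundWeight t n r) (eps n i) = if r ≤ i then weightScale t r else 0 := by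
    intro i hi hin
    rw [inner_fundWeight_eps hr (by omega)]
    congr 1
    rw [if_neg (by omega)]
  rw [inner_self_eq_sum, inner_self_eq_sum] at hnorm
  refine ext_inner_eps fun a ha han => ?_
  by_contra hne
  have hκ2 : 0 < weightScale t r ^ 2 := by positivity
  -- Both vectors have coordinates that jump once from 0 to κ. If they disagree at a, the jumps are
  -- at different places, and the squares of one are termwise at most those of the other, strictly
  -- at a.
  by_cases hra : r ≤ a
  · have hxa : inner ℝ x (eps n a) = 0 := by
      rcases hcoord a ha han with h | h
      · rw [hω a ha han, if_pos hra] at hne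
        exact absurd h hne
      · exact h
    refine absurd hnorm (Finset.sum_lt_sum ?_ ⟨a, Finset.mem_Icc.2 ⟨ha, han⟩, ?_⟩).ne
    · intro k hk
      rw [Finset.mem_Icc] at hk
      rw [hω k hk.1 hk.2]
      by_cases hka : k ≤ a
      · have h1 := hmono' k a hk.1 hka han
        have h2 := hnn k hk.1 hk.2
        rw [show inner ℝ x (eps n k) = 0 by linarith]
        simp only [ne_eq, OfNat.ofNat_ne_zero, not_false_eq_true, zero_pow]
        positivity
      · rw [if_pos (by omega)]
        rcases hcoord k hk.1 hk.2 with h | h <;> rw [h]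
        simp only [ne_eq, OfNat.ofNat_ne_zero, not_false_eq_true, zero_pow]
        positivity
    · rw [hω a ha han, if_pos hra, hxa]
      simpa using hκ2
  · have hxa : inner ℝ x (eps n a) = weightScale t r := by
      rcases hcoord a ha han with h | h
      · exact h
      · rw [hω a ha han, if_neg hra] at hne
        exact absurd h hne
    refine absurd hnorm (Finset.sum_lt_sum ?_ ⟨a, Finset.mem_Icc.2 ⟨ha, han⟩, ?_⟩).ne'
    · intro k hk
      rw [Finset.mem_Icc] at hk
      rw [hω k hk.1 hk.2]
      by_cases hka : a ≤ k
      · have h1 := hmono' a k ha hka hk.2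
        have h2 : inner ℝ x (eps n k) = weightScale t r := by
          rcases hcoord k hk.1 hk.2 with h | h
          · exact h
          · linarith
        rw [h2]
        split_ifs
        · exact le_rfl
        · simpa using hκ2.le
      · rw [if_neg (by omega)]
        simp only [ne_eq, OfNat.ofNat_ne_zero, not_false_eq_true, zero_pow]
        positivity
    · rw [hω a ha han, if_neg hra, hxa]
      simpa using hκ2

theorem simpleRefl_mul_apply {t : Kind} {n : ℕ} {i : ℤ} (hi : 1 ≤ i) (hin : i ≤ n)
    (v : weylGroup t n) (x : E n) :
    (simpleRefl t hi hin * v).1 x = refl (simpleRoot .B n i) (v.1 x) := by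
  rw [← refl_simpleRoot t]
  rfl

theorem inner_simpleRoot_pos_iff {t : Kind} {n : ℕ} {i : ℤ} (x : E n) :
    0 < inner ℝ x (simpleRoot t n i) ↔ 0 < inner ℝ x (simpleRoot .B n i) := by
  rw [simpleRoot_eq_smul, inner_smul_right]
  exact mul_pos_iff_of_pos_left (simpleScale_pos t i)

/-- Every vector with coordinates in `{0, κ, -κ}` of the right length lies in the orbit
of `ω_r`. -/
theorem exists_minReps {t : Kind} {n : ℕ} {r : ℤ} (hr : 1 ≤ r) (hrn : r ≤ n) {x : E n}
    (hx : HasSignCoords (weightScale t r) x)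
    (hnorm : inner ℝ x x = inner ℝ (fundWeight t n r) (fundWeight t n r)) :
    ∃ v ∈ minReps t n r, v.1 (fundWeight t n r) = x := by
  have hκ := weightScale_pos t r
  -- The pairing with ρ is at most κ ∑ k, and N measures the distance to this bound in units of κ.
  obtain ⟨N, hN⟩ : ∃ N : ℕ, weightScale t r * ∑ k ∈ Finset.Icc (1 : ℤ) n, (k : ℝ) -
      N * weightScale t r < inner ℝ x (rho n) := by
    obtain ⟨N, hN⟩ := exists_nat_gt ((weightScale t r * ∑ k ∈ Finset.Icc (1 : ℤ) n, (k : ℝ) -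
      inner ℝ x (rho n)) / weightScale t r)
    rw [div_lt_iff₀ hκ] at hN
    exact ⟨N, by linarith⟩
  induction N generalizing x with
  | zero =>
    have := hx.inner_rho_le hκ
    simp at hN
    linarith
  | succ N ih =>
    by_cases hdom : ∀ i : ℤ, 1 ≤ i → i ≤ n → 0 ≤ inner ℝ x (simpleRoot .B n i)
    · refine ⟨1, fun j hj hjn _ => isPosRoot_simpleRoot t hj hjn, ?_⟩
      exact (hx.eq_fundWeight hr hnorm hdom).symm
    · push Not at hdom
      obtain ⟨i, hi, hin, hneg⟩ := hdom
      -- Since (ρ, α_i) = 1, reflecting in an α_i that pairs negatively with x raises the pairing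
      -- with ρ by at least κ, which pays for one unit of N.
      obtain ⟨v, hv, hvx⟩ := ih (hx.refl_simpleRoot hi hin)
        (by rw [LinearIsometryEquiv.inner_map_map, hnorm]) (by
          have := hx.corootPairing_le hκ hi hin hneg
          have h1 := inner_simpleRoot_rho hi hin
          rw [real_inner_comm] at h1
          rw [refl_apply, inner_sub_left, inner_smul_left, h1]
          push_cast at hN
          simp only [conj_trivial]
          linarith)
      refine ⟨simpleRefl t hi hin * v, simpleRefl_mul_mem_minReps hr hrn hv hi hin ?_, ?_⟩
      · refine ((inner_simpleRoot_pos_iff _).2 ?_).ne'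
        rw [hvx, inner_refl_self]
        linarith
      · rw [simpleRefl_mul_apply, hvx, refl_refl]

/-! ### Maximal elements and sets without consecutive elements. -/

/-- A maximal element admits no further reflection step. -/
theorem not_nonneg_of_mem_maximalElements {t : Kind} {n : ℕ} {r : ℤ} (hr : 1 ≤ r) (hrn : r ≤ n)
    {v : weylGroup t n} (hv : v ∈ maximalElements t n r) {i : ℤ} (hi : 1 ≤ i) (hin : i ≤ n)
    (hpos : 0 < inner ℝ (v.1 (fundWeight t n r)) (simpleRoot .B n i)) :
    inner ℝ (v.1 (fundWeight t n r)) (fundWeight .C n i) -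
      corootPairing (v.1 (fundWeight t n r)) (simpleRoot .B n i) < 0 := by
  by_contra hnn
  rw [not_lt] at hnn
  obtain ⟨hv1, hv2, hv3⟩ := hv
  have hpos' := (inner_simpleRoot_pos_iff (t := t) (v.1 (fundWeight t n r))).2 hpos
  have h := hv3 _ (simpleRefl_mul_mem_minReps hr hrn hv1 hi hin hpos'.ne') ?_
    (BruhatLE.simpleRefl_mul hr v hi hin hpos')
  -- Maximality would give s_i v = v, so the weight would be fixed by s_i and pair to zero with α_i.
  · have h1 := simpleRefl_mul_apply hi hin v (fundWeight t n r)
    rw [h] at h1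
    have h2 := inner_refl_self (v.1 (fundWeight t n r)) (simpleRoot .B n i)
    rw [← h1] at h2
    linarith
  · rw [nonnegWeight_iff] at hv2 ⊢
    intro j hj hjn
    rw [simpleRefl_mul_apply, refl_apply, inner_sub_left, inner_smul_left, conj_trivial,
      inner_simpleRoot_fundWeight hi hin hj]
    split_ifs with hij
    · subst hij
      simpa using hnn
    · simpa using hv2 j hj hjn

/-- The sum of the simple roots with indices in `T`, where the special one is `ε_1`. -/
noncomputable def gapVec (n : ℕ) (T : Finset ℤ) : E n := ∑ i ∈ T, simpleRoot .B n i

/-- A subset of `[1,n]` without two consecutive elements. -/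
def IsGapSet (n : ℕ) (T : Finset ℤ) : Prop :=
  (∀ i ∈ T, 1 ≤ i ∧ i ≤ n) ∧ ∀ i ∈ T, i + 1 ∉ T

theorem inner_gapVec_fundWeight {n : ℕ} {T : Finset ℤ} (hT : ∀ i ∈ T, 1 ≤ i ∧ i ≤ n) {j : ℤ}
    (hj : 1 ≤ j) : inner ℝ (gapVec n T) (fundWeight .C n j) = if j ∈ T then 1 else 0 := by
  rw [← inner_sum_simpleRoot (ι := fun _ => 1) hT hj]
  simp [gapVec]

theorem inner_gapVec_eps {n : ℕ} {T : Finset ℤ} (hT : ∀ i ∈ T, 1 ≤ i ∧ i ≤ n) {j : ℤ}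
    (hj : 1 ≤ j) (hjn : j ≤ n) : inner ℝ (gapVec n T) (eps n j) =
      (if j ∈ T then 1 else 0) - if j + 1 ∈ T then 1 else 0 := by
  rw [← fundWeight_sub_fundWeight n hjn, inner_sub_right, inner_gapVec_fundWeight hT hj,
    inner_gapVec_fundWeight hT (by omega)]

/-- Each i ∈ T contributes the coordinates 1 at i and -1 at i - 1, without overlap because T has no
consecutive elements. For i = 1 the second coordinate does not exist, hence the erased 1. -/
theorem IsGapSet.inner_self {n : ℕ} {T : Finset ℤ} (hT : IsGapSet n T) :
    inner ℝ (gapVec n T) (gapVec n T) = T.card + (T.erase 1).card := by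
  have h1 : ∀ k ∈ Finset.Icc (1 : ℤ) n, inner ℝ (gapVec n T) (eps n k) ^ 2 =
      (if k ∈ T then (1 : ℝ) else 0) + if k + 1 ∈ T then 1 else 0 := by
    intro k hk
    rw [Finset.mem_Icc] at hk
    rw [inner_gapVec_eps hT.1 hk.1 hk.2]
    have := hT.2 k
    split_ifs <;> first | tauto | norm_num
  rw [inner_self_eq_sum, Finset.sum_congr rfl h1, Finset.sum_add_distrib, Finset.sum_boole,
    Finset.sum_boole]
  congr 2
  · congr 1
    ext k
    have := hT.1 k
    simp only [Finset.mem_filter, Finset.mem_Icc]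
    tauto
  · refine Finset.card_bij (fun k _ => k + 1) ?_ ?_ ?_
    · intro k hk
      simp only [Finset.mem_filter, Finset.mem_Icc, Finset.mem_erase] at hk ⊢
      exact ⟨by omega, hk.2⟩
    · intro a _ b _ hab
      omega
    · intro k hk
      rw [Finset.mem_erase] at hk
      have := hT.1 k hk.2
      refine ⟨k - 1, ?_, by ring⟩
      simp only [Finset.mem_filter, Finset.mem_Icc, sub_add_cancel]
      exact ⟨by omega, hk.2⟩

theorem inner_fundWeight_self {t : Kind} {n r : ℕ} (hr : 1 ≤ r) (hrn : r ≤ n) :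
    inner ℝ (fundWeight t n r) (fundWeight t n r) =
      weightScale t r ^ 2 * ((n + 1 - r : ℕ) : ℝ) := by
  rw [inner_self_eq_sum]
  have h1 : ∀ k ∈ Finset.Icc (1 : ℤ) n, inner ℝ (fundWeight t n r) (eps n k) ^ 2 =
      weightScale t r ^ 2 * if (r : ℤ) ≤ k then 1 else 0 := by
    intro k hk
    rw [Finset.mem_Icc] at hk
    rw [inner_fundWeight_eps (by omega) (by omega)]
    split_ifs <;> first | omega | simp
  rw [Finset.sum_congr rfl h1, ← Finset.mul_sum, Finset.sum_boole]
  congr 2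
  have : (Finset.Icc (1 : ℤ) n).filter (fun k => (r : ℤ) ≤ k) = Finset.Icc (r : ℤ) n := by
    ext k
    simp only [Finset.mem_filter, Finset.mem_Icc]
    omega
  rw [this, Int.card_Icc]
  omega

section Classification

variable {t : Kind} {n r : ℕ}

theorem IsGapSet.hasSignCoords {T : Finset ℤ} (hT : IsGapSet n T) (κ : ℝ) :
    HasSignCoords κ (κ • gapVec n T) := by
  have key : ∀ a : ℤ, 1 ≤ a → a ≤ n → inner ℝ (κ • gapVec n T) (eps n a) = κ ∨
      inner ℝ (κ • gapVec n T) (eps n a) = 0 ∨ inner ℝ (κ • gapVec n T) (eps n a) = -κ := by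
    intro a ha han
    rw [inner_smul_left, inner_gapVec_eps hT.1 ha han, conj_trivial]
    split_ifs <;> simp
  intro a ha
  rcases le_or_gt 0 a with h | h
  · exact key a (by omega) (by omega)
  · have := key (-a) (by omega) (by omega)
    rw [eps_neg, inner_neg_right] at this
    rcases this with h | h | h
    · exact Or.inr (Or.inr (by linarith))
    · exact Or.inr (Or.inl (by linarith))
    · exact Or.inl (by linarith)

theorem IsGapSet.inner_self_eq_iff (hr : 1 ≤ r) (hrn : r ≤ n) {T : Finset ℤ}
    (hT : IsGapSet n T) :
    inner ℝ (weightScale t r • gapVec n T) (weightScale t r • gapVec n T) =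
      inner ℝ (fundWeight t n r) (fundWeight t n r) ↔
      T.card + (T.erase 1).card = n + 1 - r := by
  have hκ := weightScale_pos t r
  rw [inner_smul_left, inner_smul_right, hT.inner_self, inner_fundWeight_self hr hrn, conj_trivial,
    ← mul_assoc, ← sq, mul_right_inj' (by positivity)]
  exact_mod_cast Iff.rfl

theorem IsGapSet.exists_minReps (hr : 1 ≤ r) (hrn : r ≤ n) {T : Finset ℤ}
    (hT : IsGapSet n T) (hcard : T.card + (T.erase 1).card = n + 1 - r) :
    ∃ v ∈ minReps t n r, v.1 (fundWeight t n r) = weightScale t r • gapVec n T :=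
  TypeBC.exists_minReps (by omega) (by omega) (hT.hasSignCoords _)
    ((hT.inner_self_eq_iff hr hrn).2 hcard)

theorem IsGapSet.card_eq (hr : 1 ≤ r) (hrn : r ≤ n) {T : Finset ℤ} (hT : IsGapSet n T)
    {v : weylGroup t n} (h : v.1 (fundWeight t n r) = weightScale t r • gapVec n T) :
    T.card + (T.erase 1).card = n + 1 - r := by
  refine (hT.inner_self_eq_iff (t := t) hr hrn).1 ?_
  rw [← h, LinearIsometryEquiv.inner_map_map]

theorem eq_smul_gapVec {κ : ℝ} {x : E n} {c : ℤ → ℤ}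
    (hc : ∀ j : ℤ, inner ℝ x (fundWeight .C n j) = κ * c j ∨ j < 1)
    (h01 : ∀ j : ℤ, 1 ≤ j → j ≤ n → c j = 0 ∨ c j = 1) :
    x = κ • gapVec n ((Finset.Icc (1 : ℤ) n).filter fun j => c j = 1) := by
  refine ext_inner_fundWeight fun j hj hjn => ?_
  rw [(hc j).resolve_right (by omega), inner_smul_left, conj_trivial, inner_gapVec_fundWeight _ hj]
  · rcases h01 j hj hjn with h | h
    · simp [h]
    · simp [h, hj, hjn]
  · intro i hi
    exact Finset.mem_Icc.1 (Finset.mem_filter.1 hi).1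

/-- The weight of a maximal element is a sum of pairwise orthogonal simple roots. -/
theorem exists_isGapSet_of_mem_maximalElements (hr : 1 ≤ r) (hrn : r ≤ n) {v : weylGroup t n}
    (hv : v ∈ maximalElements t n r) :
    ∃ T, IsGapSet n T ∧ v.1 (fundWeight t n r) = weightScale t r • gapVec n T := by
  have hκ := weightScale_pos t r
  have hr' : (1 : ℤ) ≤ r := by omega
  obtain ⟨c, hc, hx⟩ := (hasSignCoords_apply_fundWeight hr' v).exists_walk
  have hx' : ∀ j : ℤ, 1 ≤ j →
      inner ℝ (v.1 (fundWeight t n r)) (fundWeight .C n j) = weightScale t r * c j :=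
    fun j hj => (hx j).resolve_right (by omega)
  have heps : ∀ j : ℤ, 1 ≤ j → j ≤ n → inner ℝ (v.1 (fundWeight t n r)) (eps n j) =
      weightScale t r * ((c j - c (j + 1) : ℤ) : ℝ) := by
    intro j hj hjn
    rw [← fundWeight_sub_fundWeight n hjn, inner_sub_right, hx' j hj, hx' (j + 1) (by omega)]
    push_cast
    ring
  have h0 : ∀ i : ℤ, 1 ≤ i → i ≤ n + 1 → 0 ≤ c i := by
    intro i hi hin
    by_cases h : i ≤ n
    · have := nonnegWeight_iff.1 hv.2.1 i hi h
      rw [hx' i hi] at this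
      exact_mod_cast (mul_nonneg_iff_of_pos_left hκ).1 this
    · rw [show i = n + 1 by omega, hc.last]
  have hflat : ∀ i : ℤ, 1 ≤ i → i ≤ n → IsFlatAt c i := by
    intro i hi hin
    -- In terms of the walk, s_1 replaces c_1 by 2c_2 - c_1, and s_i with i ≥ 2 replaces c_i by
    -- c_{i+1} + c_{i-1} - c_i. The two excluded situations are thus reflections that go up and keep
    -- the weight nonnegative.
    refine hc.isFlatAt h0 ?_ ?_ hi hin
    · rintro ⟨h1, h2⟩
      have e1 := heps 1 le_rfl (by omega)
      have h1' : (0 : ℝ) < ((c 1 - c 2 : ℤ) : ℝ) := by exact_mod_cast sub_pos.2 h1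
      have h2' : (0 : ℝ) ≤ ((2 * c 2 - c 1 : ℤ) : ℝ) := by exact_mod_cast h2
      norm_num at e1
      push_cast at h1' h2'
      have := not_nonneg_of_mem_maximalElements hr' (by omega) hv (i := 1) le_rfl (by omega) (by
        rw [simpleRoot_one]
        simp only [simpleScale, one_smul]
        rw [e1]
        positivity)
      rw [corootPairing_simpleRoot_one (by omega), hx' 1 le_rfl, e1] at this
      nlinarith
    · rintro i hi hin ⟨h1, h2⟩
      have e1 := heps i (by omega) hin
      have e2 := heps (i - 1) (by omega) (by omega)
      rw [sub_add_cancel] at e2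
      have h1' : (0 : ℝ) < ((2 * c i - (c (i + 1) + c (i - 1)) : ℤ) : ℝ) := by
        exact_mod_cast sub_pos.2 h1
      have h2' : (0 : ℝ) ≤ ((c (i + 1) + c (i - 1) - c i : ℤ) : ℝ) := by exact_mod_cast h2
      push_cast at h1' h2' e1 e2
      have := not_nonneg_of_mem_maximalElements hr' (by omega) hv (i := i) (by omega) hin (by
        rw [simpleRoot_of_ne_one .B n (by omega), inner_sub_right, e1, e2]
        nlinarith)
      rw [corootPairing_simpleRoot hi hin, hx' i (by omega), e1, e2] at this
      nlinarith
  refine ⟨_, ⟨?_, ?_⟩, eq_smul_gapVec hx fun j hj hjn => (hflat j hj hjn).imp_right And.left⟩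
  · intro i hi
    exact Finset.mem_Icc.1 (Finset.mem_filter.1 hi).1
  · intro i hi hi'
    simp only [Finset.mem_filter, Finset.mem_Icc] at hi hi'
    have := hflat i hi.1.1 hi.1.2
    unfold IsFlatAt at this
    omega

/-- The elements of `W^{I_r}` whose weight is a sum of pairwise orthogonal simple roots are
maximal. -/
theorem IsGapSet.mem_maximalElements (hr : 1 ≤ r) (hrn : r ≤ n) {T : Finset ℤ} (hT : IsGapSet n T)
    {v : weylGroup t n} (hv : v ∈ minReps t n r)
    (h : v.1 (fundWeight t n r) = weightScale t r • gapVec n T) :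
    v ∈ maximalElements t n r := by
  have hκ := weightScale_pos t r
  have hr' : (1 : ℤ) ≤ r := by omega
  have hvT : ∀ j : ℤ, 1 ≤ j → inner ℝ (v.1 (fundWeight t n r)) (fundWeight .C n j) =
      weightScale t r * ((if j ∈ T then 1 else 0 : ℤ) : ℝ) := by
    intro j hj
    rw [h, inner_smul_left, conj_trivial, inner_gapVec_fundWeight hT.1 hj]
    simp
  refine ⟨hv, ?_, ?_⟩
  · refine nonnegWeight_iff.2 fun i hi _ => ?_
    rw [hvT i hi]
    split_ifs
    · simpa using hκ.le
    · simp
  · intro u hu hnn hle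
    obtain ⟨c, hc, hx⟩ := (hasSignCoords_apply_fundWeight hr' u).exists_walk
    have hx' : ∀ j : ℤ, 1 ≤ j →
        inner ℝ (u.1 (fundWeight t n r)) (fundWeight .C n j) = weightScale t r * c j :=
      fun j hj => (hx j).resolve_right (by omega)
    have h0 : ∀ j : ℤ, 1 ≤ j → j ≤ n → 0 ≤ c j := by
      intro i hi hin
      have := nonnegWeight_iff.1 hnn i hi hin
      rw [hx' i hi] at this
      exact_mod_cast (mul_nonneg_iff_of_pos_left hκ).1 this
    have h1 : ∀ j : ℤ, 1 ≤ j → c j ≤ if j ∈ T then 1 else 0 := by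
      intro j hj
      have := hle.inner_le hr' hj
      rw [hx' j hj, hvT j hj] at this
      exact_mod_cast le_of_mul_le_mul_left this hκ
    have hsub : ∀ j ∈ (Finset.Icc (1 : ℤ) n).filter (fun j => c j = 1), j ∈ T := by
      intro j hj
      simp only [Finset.mem_filter, Finset.mem_Icc] at hj
      have := h1 j hj.1.1
      by_contra hjT
      rw [if_neg hjT] at this
      omega
    have hu' := eq_smul_gapVec hx fun j hj hjn => by
      have h2 := h0 j hj hjn
      have h3 := h1 j hj
      split_ifs at h3 <;> omega
    have hU : IsGapSet n ((Finset.Icc (1 : ℤ) n).filter fun j => c j = 1) :=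
      ⟨fun i hi => hT.1 i (hsub i hi), fun i hi hi' => hT.2 i (hsub i hi) (hsub _ hi')⟩
    have c1 := hU.card_eq hr hrn hu'
    have c2 := hT.card_eq hr hrn h
    have c3 := Finset.card_le_card hsub
    have c4 := Finset.card_le_card (Finset.erase_subset_erase 1 hsub)
    -- Both cardinalities are monotone in the set and their sums agree, so neither can drop.
    have heq := Finset.eq_of_subset_of_card_le hsub (by omega)
    rw [heq, ← h] at hu'
    exact minReps_ext hr hrn hu hv hu'

theorem gapVec_injective {T U : Finset ℤ} (hT : ∀ i ∈ T, 1 ≤ i ∧ i ≤ n)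
    (hU : ∀ i ∈ U, 1 ≤ i ∧ i ≤ n) (h : gapVec n T = gapVec n U) : T = U := by
  ext j
  by_cases hj : 1 ≤ j
  · have h1 := inner_gapVec_fundWeight hT hj
    rw [h, inner_gapVec_fundWeight hU hj] at h1
    by_cases h2 : j ∈ T <;> by_cases h3 : j ∈ U <;> simp_all
  · have h1 := hT j
    have h2 := hU j
    constructor <;> intro h3
    · exact absurd (h1 h3).1 hj
    · exact absurd (h2 h3).1 hj

/-- The window of the element of `W^{I_r}` attached to a set `T`. -/
theorem IsGapSet.isWindow_append (hr : 1 ≤ r) (hrn : r ≤ n) {T : Finset ℤ} (hT : IsGapSet n T)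
    {v : weylGroup t n} (hv : v ∈ minReps t n r)
    (h : v.1 (fundWeight t n r) = weightScale t r • gapVec n T) {l l' : List ℤ}
    (hl : l.Pairwise (· < ·)) (hl' : l'.Pairwise (· < ·))
    (hmem : ∀ a, a ∈ l ↔ 1 ≤ a ∧ a ≤ n ∧ a ∉ T ∧ a + 1 ∉ T)
    (hmem' : ∀ a, a ∈ l' ↔ a ∈ T ∨ a < 0 ∧ 1 - a ∈ T) :
    IsWindow v (l ++ l') := by
  have hκ := weightScale_pos t r
  refine TypeBC.isWindow_append hr hrn hv hl hl' ?_ ?_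
  · intro a
    rw [hmem, h, inner_smul_left, conj_trivial, mul_eq_zero]
    refine and_congr_right fun h1 => and_congr_right fun h2 => ?_
    rw [inner_gapVec_eps hT.1 h1 h2]
    have := hT.2 a
    by_cases h3 : a ∈ T <;> by_cases h4 : a + 1 ∈ T <;> simp_all [hκ.ne']
  · intro a
    have h1 := hT.1 a
    have h2 := hT.1 (1 - a)
    rw [hmem', h, inner_smul_left, conj_trivial, mul_pos_iff_of_pos_left hκ]
    by_cases hi : IsIndex n a
    · rw [and_iff_right hi]
      rcases le_or_gt 0 a with h5 | h5
      · rw [inner_gapVec_eps hT.1 (by omega) (by omega)]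
        have := hT.2 a
        by_cases h3 : a ∈ T <;> by_cases h4 : a + 1 ∈ T <;> simp_all [h5.not_gt]
      · have e := inner_gapVec_eps hT.1 (j := -a) (by omega) (by omega)
        have h6 : a ∉ T := fun h => by have := h1 h; omega
        have h7 := hT.2 (-a)
        rw [eps_neg, inner_neg_right, neg_add_eq_sub] at e
        rw [neg_eq_iff_eq_neg.1 e]
        rw [neg_add_eq_sub] at h7
        by_cases h3 : -a ∈ T <;> by_cases h4 : 1 - a ∈ T <;> simp_all
    · refine iff_of_false ?_ fun h3 => hi h3.1
      rintro (h3 | ⟨h3, h4⟩)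
      · have := h1 h3
        omega
      · have := h2 h4
        omega

end Classification

/-! ### Translation between gap sequences and sets. -/

theorem pairwise_of_mem_gapSeqs {m : ℕ} {s e : ℤ} {i : List ℤ} (hi : i ∈ gapSeqs m s e) :
    i.Pairwise fun x y => 2 ≤ y - x := by
  have : IsTrans ℤ fun x y : ℤ => 2 ≤ y - x := ⟨fun a b c h1 h2 => by omega⟩
  exact List.isChain_iff_pairwise.1 hi.2.2

theorem pairwise_lt_of_mem_gapSeqs {m : ℕ} {s e : ℤ} {i : List ℤ} (hi : i ∈ gapSeqs m s e) :
    i.Pairwise (· < ·) :=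
  (pairwise_of_mem_gapSeqs hi).imp fun h => by omega

theorem gapSeqs_nodup {m : ℕ} {s e : ℤ} {i : List ℤ} (hi : i ∈ gapSeqs m s e) : i.Nodup :=
  (pairwise_lt_of_mem_gapSeqs hi).imp ne_of_lt

theorem succ_notMem_of_mem_gapSeqs {m : ℕ} {s e : ℤ} {i : List ℤ} (hi : i ∈ gapSeqs m s e)
    {x : ℤ} (hx : x ∈ i) : x + 1 ∉ i := by
  intro hx'
  have h := List.pairwise_iff_getElem.1 (pairwise_of_mem_gapSeqs hi)
  obtain ⟨p, hp, hpx⟩ := List.getElem_of_mem hx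
  obtain ⟨q, hq, hqx⟩ := List.getElem_of_mem hx'
  rcases lt_trichotomy p q with hpq | rfl | hpq
  · have := h p q hp hq hpq
    omega
  · omega
  · have := h q p hq hp hpq
    omega

theorem isGapSet_toFinset {m n : ℕ} {s : ℤ} (hs : 1 ≤ s) {i : List ℤ} (hi : i ∈ gapSeqs m s n) :
    IsGapSet n i.toFinset := by
  refine ⟨fun x hx => ?_, fun x hx => ?_⟩
  · have := hi.2.1 x (List.mem_toFinset.1 hx)
    omega
  · rw [List.mem_toFinset] at hx ⊢
    exact succ_notMem_of_mem_gapSeqs hi hx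

theorem isGapSet_insert_one {m n : ℕ} (hn : 1 ≤ n) {i : List ℤ} (hi : i ∈ gapSeqs m 3 n) :
    IsGapSet n (insert 1 i.toFinset) := by
  have h := isGapSet_toFinset (by norm_num) hi
  refine ⟨fun x hx => ?_, fun x hx hx' => ?_⟩
  · rcases Finset.mem_insert.1 hx with rfl | hx
    · omega
    · exact h.1 x hx
  · rcases Finset.mem_insert.1 hx with rfl | hx <;> rcases Finset.mem_insert.1 hx' with h' | h'
    · omega
    · have := hi.2.1 _ (List.mem_toFinset.1 h')
      omega
    · have := h.1 x hx
      omega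
    · exact h.2 x hx h'

theorem card_toFinset {m : ℕ} {s e : ℤ} {i : List ℤ} (hi : i ∈ gapSeqs m s e) :
    i.toFinset.card = m := by
  rw [List.toFinset_card_of_nodup (gapSeqs_nodup hi), hi.1]

theorem one_notMem_toFinset {m : ℕ} {s e : ℤ} (hs : 2 ≤ s) {i : List ℤ} (hi : i ∈ gapSeqs m s e) :
    1 ∉ i.toFinset := by
  intro h
  have := hi.2.1 1 (List.mem_toFinset.1 h)
  omega

theorem rootSum_eq_gapVec {t : Kind} {n m : ℕ} {s e : ℤ} (hs : 2 ≤ s) {i : List ℤ}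
    (hi : i ∈ gapSeqs m s e) : rootSum t n i = gapVec n i.toFinset := by
  rw [gapVec, List.sum_toFinset _ (gapSeqs_nodup hi), rootSum]
  congr 1
  refine List.map_congr_left fun x hx => ?_
  have := hi.2.1 x hx
  rw [simpleRoot_of_ne_one t n (by omega), simpleRoot_of_ne_one .B n (by omega)]

/-- The factor ½ in type C undoes the doubling of α_1, so both types lead to the same vector
`gapVec`. -/
theorem alphaOneCoeff_smul (t : Kind) (n : ℕ) :
    alphaOneCoeff t • simpleRoot t n 1 = simpleRoot .B n 1 := by
  cases t <;> simp [alphaOneCoeff, simpleRoot, smul_smul]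

theorem alphaOne_add_rootSum_eq_gapVec {t : Kind} {n m : ℕ} {e : ℤ} {i : List ℤ}
    (hi : i ∈ gapSeqs m 3 e) :
    alphaOneCoeff t • simpleRoot t n 1 + rootSum t n i = gapVec n (insert 1 i.toFinset) := by
  rw [rootSum_eq_gapVec (by norm_num) hi, alphaOneCoeff_smul, gapVec, gapVec,
    Finset.sum_insert (one_notMem_toFinset (by norm_num) hi)]

theorem sort_mem_gapSeqs {T : Finset ℤ} {s e : ℤ} (hT : ∀ x ∈ T, s ≤ x ∧ x ≤ e)
    (hgap : ∀ x ∈ T, x + 1 ∉ T) : T.sort (· ≤ ·) ∈ gapSeqs T.card s e := by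
  refine ⟨Finset.length_sort _, fun x hx => hT x ((Finset.mem_sort _).1 hx), ?_⟩
  refine List.Pairwise.isChain ((Finset.sortedLT_sort T).pairwise.imp_of_mem ?_)
  intro a b ha hb hab
  rw [Finset.mem_sort] at ha hb
  by_contra h
  rw [show b = a + 1 by omega] at hb
  exact hgap a ha hb

theorem gapSeqs_ext {m : ℕ} {s e : ℤ} {i j : List ℤ} (hi : i ∈ gapSeqs m s e)
    (hj : j ∈ gapSeqs m s e) (h : i.toFinset = j.toFinset) : i = j :=
  eq_of_pairwise_lt (pairwise_lt_of_mem_gapSeqs hi) (pairwise_lt_of_mem_gapSeqs hj) fun a => by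
    rw [← List.mem_toFinset, h, List.mem_toFinset]

theorem mem_negRev_predSeq {i : List ℤ} {a : ℤ} : a ∈ negRev (predSeq i) ↔ 1 - a ∈ i := by
  simp only [negRev, predSeq, List.mem_reverse, List.mem_map, exists_exists_and_eq_and]
  constructor
  · rintro ⟨x, hx, rfl⟩
    simpa using hx
  · intro h
    exact ⟨_, h, by ring⟩

theorem pairwise_negRev_predSeq {i : List ℤ} (hi : i.Pairwise (· < ·)) :
    (negRev (predSeq i)).Pairwise (· < ·) := by
  rw [negRev, predSeq, List.pairwise_reverse, List.map_map, List.pairwise_map]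
  refine hi.imp fun h => ?_
  simp only [Function.comp_apply]
  omega

theorem weightScale_of_two_le (t : Kind) {r : ℕ} (hr : 2 ≤ r) : weightScale t r = 1 := by
  cases t
  · simp only [weightScale]
    rw [if_neg (by omega)]
  · rfl

/-! ### The individual cases. -/

section Cases

variable {t : Kind} {n r m : ℕ}

theorem isWindow_windowEven (hr : 1 ≤ r) (hrn : r ≤ n) {i : List ℤ} (hi : i ∈ gapSeqs m 2 n)
    {v : weylGroup t n} (hv : v ∈ minReps t n r)
    (h : v.1 (fundWeight t n r) = weightScale t r • gapVec n i.toFinset) :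
    IsWindow v (windowEven n i) := by
  have hlt := pairwise_lt_of_mem_gapSeqs hi
  rw [windowEven, List.append_assoc]
  refine (isGapSet_toFinset (by norm_num) hi).isWindow_append hr hrn hv h
    (Finset.sortedLT_sort _).pairwise ?_ ?_ ?_
  · refine List.pairwise_append.2 ⟨pairwise_negRev_predSeq hlt, hlt, fun a ha b hb => ?_⟩
    have h1 := hi.2.1 _ (mem_negRev_predSeq.1 ha)
    have h2 := hi.2.1 _ hb
    omega
  · intro a
    have : a ∈ predSeq i ↔ a + 1 ∈ i := by
      simp only [predSeq, List.mem_map]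
      exact ⟨by rintro ⟨x, hx, rfl⟩; simpa using hx, fun h => ⟨_, h, by ring⟩⟩
    simp only [Finset.mem_sort, Finset.mem_sdiff, Finset.mem_Icc, Finset.mem_union,
      List.mem_toFinset, this]
    tauto
  · intro a
    rw [List.mem_append, mem_negRev_predSeq, List.mem_toFinset, List.mem_toFinset]
    have := hi.2.1 (1 - a)
    constructor
    · rintro (h | h)
      · exact Or.inr ⟨by have := this h; omega, h⟩
      · exact Or.inl h
    · rintro (h | ⟨_, h⟩)
      exacts [Or.inr h, Or.inl h]

theorem isWindow_windowOdd (hr : 1 ≤ r) (hrn : r ≤ n) {i : List ℤ} (hi : i ∈ gapSeqs m 3 n)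
    {v : weylGroup t n} (hv : v ∈ minReps t n r)
    (h : v.1 (fundWeight t n r) = weightScale t r • gapVec n (insert 1 i.toFinset)) :
    IsWindow v (windowOdd n i) := by
  have hlt := pairwise_lt_of_mem_gapSeqs hi
  rw [windowOdd, List.append_assoc, List.append_assoc]
  refine (isGapSet_insert_one (by omega) hi).isWindow_append hr hrn hv h
    (Finset.sortedLT_sort _).pairwise ?_ ?_ ?_
  · refine List.pairwise_append.2 ⟨pairwise_negRev_predSeq hlt, ?_, fun a ha b hb => ?_⟩
    · refine List.pairwise_cons.2 ⟨fun b hb => ?_, hlt⟩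
      have h2 := hi.2.1 _ hb
      omega
    · have h1 := hi.2.1 _ (mem_negRev_predSeq.1 ha)
      rcases List.mem_cons.1 hb with rfl | hb
      · omega
      · have h2 := hi.2.1 _ hb
        omega
  · intro a
    have : a ∈ predSeq i ↔ a + 1 ∈ i := by
      simp only [predSeq, List.mem_map]
      exact ⟨by rintro ⟨x, hx, rfl⟩; simpa using hx, fun h => ⟨_, h, by ring⟩⟩
    simp only [Finset.mem_sort, Finset.mem_sdiff, Finset.mem_Icc, Finset.mem_union,
      List.mem_toFinset, this, Finset.mem_insert, Finset.mem_singleton]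
    have h0 : 1 ≤ a → a + 1 ≠ 1 := by omega
    tauto
  · intro a
    rw [List.mem_append, mem_negRev_predSeq, List.mem_append, List.mem_singleton,
      Finset.mem_insert, Finset.mem_insert, List.mem_toFinset, List.mem_toFinset]
    have := hi.2.1 (1 - a)
    constructor
    · rintro (h | h | h)
      · exact Or.inr ⟨by have := this h; omega, Or.inr h⟩
      · exact Or.inl (Or.inl h)
      · exact Or.inl (Or.inr h)
    · rintro ((h | h) | ⟨h1, h | h⟩)
      · exact Or.inr (Or.inl h)
      · exact Or.inr (Or.inr h)
      · omega
      · exact Or.inl h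

/-- If only one set `T` has the right cardinality, then there is exactly one maximal element. -/
theorem maximalElements_eq_singleton (hr : 1 ≤ r) (hrn : r ≤ n) {T : Finset ℤ}
    (hT : IsGapSet n T) (hcard : T.card + (T.erase 1).card = n + 1 - r)
    (huniq : ∀ U, IsGapSet n U → U.card + (U.erase 1).card = n + 1 - r → U = T)
    {l l' : List ℤ} (hl : l.Pairwise (· < ·)) (hl' : l'.Pairwise (· < ·))
    (hmem : ∀ a, a ∈ l ↔ 1 ≤ a ∧ a ≤ n ∧ a ∉ T ∧ a + 1 ∉ T)
    (hmem' : ∀ a, a ∈ l' ↔ a ∈ T ∨ a < 0 ∧ 1 - a ∈ T) :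
    ∃ v : weylGroup t n, maximalElements t n r = {v} ∧ IsWindow v (l ++ l') := by
  obtain ⟨v, hv, hvT⟩ := hT.exists_minReps (t := t) hr hrn hcard
  refine ⟨v, ?_, hT.isWindow_append hr hrn hv hvT hl hl' hmem hmem'⟩
  ext u
  rw [Set.mem_singleton_iff]
  constructor
  · intro hu
    obtain ⟨U, hU, huU⟩ := exists_isGapSet_of_mem_maximalElements hr hrn hu
    rw [huniq U hU (hU.card_eq hr hrn huU), ← hvT] at huU
    exact minReps_ext hr hrn hu.1 hv huU
  · rintro rfl
    exact hT.mem_maximalElements hr hrn hv hvT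

/-- The set `T` with `|T| + |T ∖ {1}| = n` consists of every second number, down from `n`. -/
theorem IsGapSet.mem_iff_of_card {T : Finset ℤ} (hT : IsGapSet n T)
    (hcard : T.card + (T.erase 1).card = n) (d : ℕ) (hd : d < n) :
    (n : ℤ) - d ∈ T ↔ d % 2 = 0 := by
  -- T and (T ∖ {1}) - 1 are disjoint subsets of [1,n] with n elements in total, so they cover
  -- [1,n].
  have hall : ∀ k : ℤ, 1 ≤ k → k ≤ n → k ∈ T ∨ k + 1 ∈ T := by
    have hsub : T ∪ (T.erase 1).image (fun k => k - 1) ⊆ Finset.Icc (1 : ℤ) n := by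
      intro k hk
      rw [Finset.mem_union, Finset.mem_image] at hk
      rw [Finset.mem_Icc]
      rcases hk with hk | ⟨j, hj, rfl⟩
      · exact hT.1 k hk
      · rw [Finset.mem_erase] at hj
        have := hT.1 j hj.2
        omega
    have hdisj : Disjoint T ((T.erase 1).image fun k => k - 1) := by
      rw [Finset.disjoint_left]
      intro k hk hk'
      obtain ⟨j, hj, rfl⟩ := Finset.mem_image.1 hk'
      exact hT.2 _ hk (by simpa using (Finset.mem_erase.1 hj).2)
    have heq := Finset.eq_of_subset_of_card_le hsub (by
      rw [Finset.card_union_of_disjoint hdisj,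
        Finset.card_image_of_injective _ (sub_left_injective (b := (1 : ℤ))), hcard]
      simp)
    intro k hk hkn
    have : k ∈ T ∪ (T.erase 1).image (fun k => k - 1) := by
      rw [heq]
      exact Finset.mem_Icc.2 ⟨hk, hkn⟩
    rw [Finset.mem_union, Finset.mem_image] at this
    rcases this with h | ⟨j, hj, rfl⟩
    · exact Or.inl h
    · right
      simpa using (Finset.mem_erase.1 hj).2
  induction d with
  | zero =>
    have h1 := hall n (by omega) le_rfl
    -- This starts the alternation: n must be in T because n + 1 is out of range.
    have h2 : (n : ℤ) + 1 ∉ T := fun h => by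
      have := hT.1 _ h
      omega
    simpa using h1.resolve_right h2
  | succ d ih =>
    have h1 : (n : ℤ) - d ∈ T ↔ d % 2 = 0 := ih (by omega)
    have h2 := hall ((n : ℤ) - (d + 1 : ℕ)) (by omega) (by omega)
    have h3 := hT.2 ((n : ℤ) - (d + 1 : ℕ))
    have e : (n : ℤ) - (d + 1 : ℕ) + 1 = n - d := by
      push_cast
      ring
    rw [e] at h2 h3
    have h4 : (d + 1) % 2 = 0 ↔ ¬ d % 2 = 0 := by omega
    rw [h4, ← h1]
    tauto

theorem IsGapSet.eq_of_card {T U : Finset ℤ} (hT : IsGapSet n T) (hU : IsGapSet n U)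
    (hTc : T.card + (T.erase 1).card = n) (hUc : U.card + (U.erase 1).card = n) : T = U := by
  ext k
  by_cases hk : 1 ≤ k ∧ k ≤ n
  · have e : (n : ℤ) - ((n : ℤ) - k).toNat = k := by omega
    have h1 := hT.mem_iff_of_card hTc ((n : ℤ) - k).toNat (by omega)
    have h2 := hU.mem_iff_of_card hUc ((n : ℤ) - k).toNat (by omega)
    rw [e] at h1 h2
    rw [h1, h2]
  · exact iff_of_false (fun h => hk (hT.1 k h)) fun h => hk (hU.1 k h)

theorem pairwise_lt_map_range {f : ℕ → ℤ} (hf : StrictMono f) (p : ℕ) :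
    ((List.range p).map f).Pairwise (· < ·) := by
  rw [List.pairwise_map]
  exact List.pairwise_lt_range.imp fun h => hf h

theorem maximalElements_one_even {p : ℕ} (hn1 : 1 ≤ n) (hn : n = 2 * p) :
    ∃ v : weylGroup t n, maximalElements t n (1 : ℕ) = {v} ∧
      IsWindow v
        (((List.range p).map fun k : ℕ => -((n : ℤ) - 1) + 2 * (k : ℤ)) ++
          (List.range p).map fun k : ℕ => 2 * (k : ℤ) + 2) := by
  have hB : ((List.range p).map fun k : ℕ => 2 * (k : ℤ) + 2).Pairwise (· < ·) :=
    pairwise_lt_map_range (fun a b h => by omega) p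
  have hA : ((List.range p).map fun k : ℕ => -((n : ℤ) - 1) + 2 * (k : ℤ)).Pairwise (· < ·) :=
    pairwise_lt_map_range (fun a b h => by omega) p
  have hmT : ∀ a : ℤ, a ∈ ((List.range p).map fun k : ℕ => 2 * (k : ℤ) + 2).toFinset ↔
      2 ≤ a ∧ a ≤ n ∧ a % 2 = 0 := by
    intro a
    simp only [List.mem_toFinset, List.mem_map, List.mem_range]
    constructor
    · rintro ⟨k, hk, rfl⟩
      omega
    · intro h
      exact ⟨(a / 2 - 1).toNat, by omega, by omega⟩
  have hT : IsGapSet n ((List.range p).map fun k : ℕ => 2 * (k : ℤ) + 2).toFinset := by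
    refine ⟨fun a ha => ?_, fun a ha ha' => ?_⟩
    · rw [hmT] at ha
      omega
    · rw [hmT] at ha ha'
      omega
  have hc : ((List.range p).map fun k : ℕ => 2 * (k : ℤ) + 2).toFinset.card = p := by
    rw [List.toFinset_card_of_nodup (hB.imp ne_of_lt)]
    simp
  have hcard : ((List.range p).map fun k : ℕ => 2 * (k : ℤ) + 2).toFinset.card +
      (((List.range p).map fun k : ℕ => 2 * (k : ℤ) + 2).toFinset.erase 1).card = n := by
    rw [Finset.erase_eq_of_notMem (by rw [hmT]; omega), hc]
    omega
  -- For r = 1 the weight has no zero coordinates, so the first block of the window is empty.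
  refine maximalElements_eq_singleton (l := []) le_rfl hn1 hT (by omega)
    (fun U hU hUc => hU.eq_of_card hT (by omega) hcard) List.Pairwise.nil
    (List.pairwise_append.2 ⟨hA, hB, ?_⟩) ?_ ?_
  · intro a ha b hb
    simp only [List.mem_map, List.mem_range] at ha hb
    obtain ⟨k, hk, rfl⟩ := ha
    obtain ⟨j, hj, rfl⟩ := hb
    omega
  · intro a
    rw [hmT, hmT]
    simp only [List.not_mem_nil, false_iff]
    omega
  · intro a
    refine List.mem_append.trans ?_
    rw [← List.mem_toFinset (l := (List.range p).map fun k : ℕ => 2 * (k : ℤ) + 2),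
      hmT, hmT]
    simp only [List.mem_map, List.mem_range]
    constructor
    · rintro (⟨k, hk, rfl⟩ | h) <;> omega
    · rintro (h | h)
      · exact Or.inr h
      · exact Or.inl ⟨((a + n - 1) / 2).toNat, by omega, by omega⟩

theorem maximalElements_one_odd {p : ℕ} (hn : n = 2 * p + 1) :
    ∃ v : weylGroup t n, maximalElements t n (1 : ℕ) = {v} ∧
      IsWindow v
        (((List.range p).map fun k : ℕ => -((n : ℤ) - 1) + 2 * (k : ℤ)) ++
          (List.range (p + 1)).map fun k : ℕ => 2 * (k : ℤ) + 1) := by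
  have hB : ((List.range (p + 1)).map fun k : ℕ => 2 * (k : ℤ) + 1).Pairwise (· < ·) :=
    pairwise_lt_map_range (fun a b h => by omega) (p + 1)
  have hA : ((List.range p).map fun k : ℕ => -((n : ℤ) - 1) + 2 * (k : ℤ)).Pairwise (· < ·) :=
    pairwise_lt_map_range (fun a b h => by omega) p
  have hmT : ∀ a : ℤ, a ∈ ((List.range (p + 1)).map fun k : ℕ => 2 * (k : ℤ) + 1).toFinset ↔
      1 ≤ a ∧ a ≤ n ∧ a % 2 = 1 := by
    intro a
    simp only [List.mem_toFinset, List.mem_map, List.mem_range]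
    constructor
    · rintro ⟨k, hk, rfl⟩
      omega
    · intro h
      exact ⟨(a / 2).toNat, by omega, by omega⟩
  have hT : IsGapSet n ((List.range (p + 1)).map fun k : ℕ => 2 * (k : ℤ) + 1).toFinset := by
    refine ⟨fun a ha => ?_, fun a ha ha' => ?_⟩
    · rw [hmT] at ha
      omega
    · rw [hmT] at ha ha'
      omega
  have hc : ((List.range (p + 1)).map fun k : ℕ => 2 * (k : ℤ) + 1).toFinset.card = p + 1 := by
    rw [List.toFinset_card_of_nodup (hB.imp ne_of_lt)]
    simp
  have hcard : ((List.range (p + 1)).map fun k : ℕ => 2 * (k : ℤ) + 1).toFinset.card +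
      (((List.range (p + 1)).map fun k : ℕ => 2 * (k : ℤ) + 1).toFinset.erase 1).card = n := by
    rw [Finset.card_erase_of_mem (by rw [hmT]; omega), hc]
    omega
  refine maximalElements_eq_singleton (l := []) le_rfl (by omega) hT (by omega)
    (fun U hU hUc => hU.eq_of_card hT (by omega) hcard) List.Pairwise.nil
    (List.pairwise_append.2 ⟨hA, hB, ?_⟩) ?_ ?_
  · intro a ha b hb
    simp only [List.mem_map, List.mem_range] at ha hb
    obtain ⟨k, hk, rfl⟩ := ha
    obtain ⟨j, hj, rfl⟩ := hb
    omega
  · intro a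
    rw [hmT, hmT]
    simp only [List.not_mem_nil, false_iff]
    omega
  · intro a
    refine List.mem_append.trans ?_
    rw [← List.mem_toFinset (l := (List.range (p + 1)).map fun k : ℕ => 2 * (k : ℤ) + 1), hmT, hmT]
    simp only [List.mem_map, List.mem_range]
    constructor
    · rintro (⟨k, hk, rfl⟩ | h) <;> omega
    · rintro (h | h)
      · exact Or.inr h
      · exact Or.inl ⟨((a + n - 1) / 2).toNat, by omega, by omega⟩

theorem maximalElements_last (hn : 1 ≤ n) :
    ∃ v : weylGroup t n, maximalElements t n n = {v} ∧
      IsWindow v (((List.range (n - 1)).map fun k : ℕ => (k : ℤ) + 2) ++ [1]) := by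
  have hT : IsGapSet n {1} := by
    refine ⟨fun a ha => ?_, fun a ha ha' => ?_⟩
    · rw [Finset.mem_singleton] at ha
      omega
    · rw [Finset.mem_singleton] at ha ha'
      omega
  refine maximalElements_eq_singleton hn le_rfl hT (by simp) ?_
    (pairwise_lt_map_range (fun a b h => by omega) _) (List.pairwise_singleton _ _) ?_ ?_
  · intro U _ hUc
    -- The two cardinalities add up to n + 1 - n = 1 and differ by at most one, so U ∖ {1} is empty.
    have h1 := Finset.pred_card_le_card_erase (s := U) (a := 1)
    have h2 := Finset.card_erase_le (s := U) (a := 1)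
    have h3 : (U.erase 1).card = 0 := by omega
    rw [Finset.card_eq_zero, Finset.erase_eq_empty_iff] at h3
    rcases h3 with rfl | h3
    · simp at hUc
    · exact h3
  · intro a
    simp only [List.mem_map, List.mem_range, Finset.mem_singleton]
    constructor
    · rintro ⟨k, hk, rfl⟩
      omega
    · intro h
      exact ⟨(a - 2).toNat, by omega, by omega⟩
  · intro a
    simp only [List.mem_singleton, Finset.mem_singleton]
    omega

theorem maximalElements_even (hr : 2 ≤ r) (hrn : r < n) (hn : n + 1 = r + 2 * m) :
    (∀ i ∈ gapSeqs m 2 n, ∃ v ∈ maximalElements t n r,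
      v.1 (fundWeight t n r) = rootSum t n i ∧
      IsWindow v (windowEven n i) ∧
      ∀ u ∈ minReps t n r, u.1 (fundWeight t n r) = rootSum t n i → u = v) ∧
    ∀ v ∈ maximalElements t n r,
      ∃! i : List ℤ, i ∈ gapSeqs m 2 n ∧ v.1 (fundWeight t n r) = rootSum t n i := by
  have hκ := weightScale_of_two_le t hr
  have hr1 : 1 ≤ r := by omega
  constructor
  · intro i hi
    have hT := isGapSet_toFinset (by norm_num) hi
    obtain ⟨v, hv, hvT⟩ := hT.exists_minReps (t := t) hr1 hrn.le (by
      rw [Finset.erase_eq_of_notMem (one_notMem_toFinset le_rfl hi), card_toFinset hi]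
      omega)
    have hvi : v.1 (fundWeight t n r) = rootSum t n i := by
      rw [hvT, hκ, one_smul, rootSum_eq_gapVec le_rfl hi]
    exact ⟨v, hT.mem_maximalElements hr1 hrn.le hv hvT, hvi,
      isWindow_windowEven hr1 hrn.le hi hv hvT,
      fun u hu hui => minReps_ext hr1 hrn.le hu hv (hui.trans hvi.symm)⟩
  · intro v hv
    obtain ⟨T, hT, hvT⟩ := exists_isGapSet_of_mem_maximalElements hr1 hrn.le hv
    have hcard := hT.card_eq hr1 hrn.le hvT
    -- If 1 were in T, the sum of cardinalities would be 2|T| - 1, which is odd.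
    have h1 : 1 ∉ T := by
      intro h
      rw [Finset.card_erase_of_mem h] at hcard
      have := Finset.card_pos.2 ⟨1, h⟩
      omega
    rw [Finset.erase_eq_of_notMem h1] at hcard
    rw [hκ, one_smul] at hvT
    have hi : T.sort (· ≤ ·) ∈ gapSeqs m 2 n := by
      rw [show m = T.card by omega]
      refine sort_mem_gapSeqs (fun x hx => ?_) hT.2
      have := hT.1 x hx
      have : x ≠ 1 := fun h => h1 (h ▸ hx)
      omega
    refine ⟨_, ⟨hi, ?_⟩, ?_⟩
    · rw [rootSum_eq_gapVec le_rfl hi, Finset.sort_toFinset, hvT]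
    · rintro j ⟨hj, hvj⟩
      refine gapSeqs_ext hj hi ?_
      rw [rootSum_eq_gapVec le_rfl hj, hvT] at hvj
      rw [Finset.sort_toFinset]
      exact (gapVec_injective hT.1 (isGapSet_toFinset (by norm_num) hj).1 hvj).symm

theorem maximalElements_odd (hr : 2 ≤ r) (hrn : r < n) (hn : n + 1 = r + (2 * m + 1)) :
    (∀ i ∈ gapSeqs m 3 n, ∃ v ∈ maximalElements t n r,
      v.1 (fundWeight t n r) = alphaOneCoeff t • simpleRoot t n 1 + rootSum t n i ∧
      IsWindow v (windowOdd n i) ∧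
      ∀ u ∈ minReps t n r,
        u.1 (fundWeight t n r) = alphaOneCoeff t • simpleRoot t n 1 + rootSum t n i → u = v) ∧
    ∀ v ∈ maximalElements t n r,
      ∃! i : List ℤ, i ∈ gapSeqs m 3 n ∧
        v.1 (fundWeight t n r) = alphaOneCoeff t • simpleRoot t n 1 + rootSum t n i := by
  have hκ := weightScale_of_two_le t hr
  have hr1 : 1 ≤ r := by omega
  constructor
  · intro i hi
    have hT := isGapSet_insert_one (by omega) hi
    have h1 := one_notMem_toFinset (by norm_num) hi
    obtain ⟨v, hv, hvT⟩ := hT.exists_minReps (t := t) hr1 hrn.le (by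
      rw [Finset.erase_insert h1, Finset.card_insert_of_notMem h1, card_toFinset hi]
      omega)
    have hvi : v.1 (fundWeight t n r) = alphaOneCoeff t • simpleRoot t n 1 + rootSum t n i := by
      rw [hvT, hκ, one_smul, alphaOne_add_rootSum_eq_gapVec hi]
    exact ⟨v, hT.mem_maximalElements hr1 hrn.le hv hvT, hvi,
      isWindow_windowOdd hr1 hrn.le hi hv hvT,
      fun u hu hui => minReps_ext hr1 hrn.le hu hv (hui.trans hvi.symm)⟩
  · intro v hv
    obtain ⟨T, hT, hvT⟩ := exists_isGapSet_of_mem_maximalElements hr1 hrn.le hv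
    have hcard := hT.card_eq hr1 hrn.le hvT
    -- If 1 were not in T, the sum of cardinalities would be 2|T|, which is even.
    have h1 : 1 ∈ T := by
      by_contra h
      rw [Finset.erase_eq_of_notMem h] at hcard
      omega
    have hpos := Finset.card_pos.2 ⟨1, h1⟩
    have hc := Finset.card_erase_of_mem h1
    rw [hκ, one_smul] at hvT
    have hi : (T.erase 1).sort (· ≤ ·) ∈ gapSeqs m 3 n := by
      rw [show m = (T.erase 1).card by omega]
      refine sort_mem_gapSeqs (fun x hx => ?_) fun x hx hx' =>
        hT.2 x (Finset.mem_of_mem_erase hx) (Finset.mem_of_mem_erase hx')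
      rw [Finset.mem_erase] at hx
      have := hT.1 x hx.2
      -- With 1 ∈ T the neighbour 2 is excluded, hence the lower bound 3 for the sequences.
      have : x ≠ 2 := fun h => hT.2 1 h1 (by simpa [h] using hx.2)
      omega
    refine ⟨_, ⟨hi, ?_⟩, ?_⟩
    · rw [alphaOne_add_rootSum_eq_gapVec hi, Finset.sort_toFinset, Finset.insert_erase h1, hvT]
    · rintro j ⟨hj, hvj⟩
      refine gapSeqs_ext hj hi ?_
      rw [alphaOne_add_rootSum_eq_gapVec hj, hvT] at hvj
      rw [Finset.sort_toFinset,
        gapVec_injective hT.1 (isGapSet_insert_one (by omega) hj).1 hvj,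
        Finset.erase_insert (one_notMem_toFinset (by norm_num) hj)]

end Cases

end TypeBC

open TypeBC in
theorem proposition4p1 (t : Kind) (n r : ℕ) (hr : 1 ≤ r) (hrn : r ≤ n) :
    -- the case `r = 1`, `n = 2p` even: `(-(n-1), -(n-3), …, -1, 2, 4, …, n)`
    (∀ p : ℕ, r = 1 → n = 2 * p →
      ∃ v : weylGroup t n, maximalElements t n r = {v} ∧
        IsWindow v
          (((List.range p).map fun k : ℕ => -((n : ℤ) - 1) + 2 * (k : ℤ)) ++
            (List.range p).map fun k : ℕ => 2 * (k : ℤ) + 2)) ∧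
    -- the case `r = 1`, `n = 2p + 1` odd: `(-(n-1), -(n-3), …, -2, 1, 3, …, n)`
    (∀ p : ℕ, r = 1 → n = 2 * p + 1 →
      ∃ v : weylGroup t n, maximalElements t n r = {v} ∧
        IsWindow v
          (((List.range p).map fun k : ℕ => -((n : ℤ) - 1) + 2 * (k : ℤ)) ++
            (List.range (p + 1)).map fun k : ℕ => 2 * (k : ℤ) + 1)) ∧
    -- the case `2 ≤ r ≤ n - 1`, `n + 1 - r = 2m`
    (∀ m : ℕ, 2 ≤ r → r < n → n + 1 = r + 2 * m →
      (∀ i ∈ gapSeqs m 2 n, ∃ v ∈ maximalElements t n r,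
        v.1 (fundWeight t n r) = rootSum t n i ∧
        IsWindow v (windowEven n i) ∧
        ∀ u ∈ minReps t n r, u.1 (fundWeight t n r) = rootSum t n i → u = v) ∧
      ∀ v ∈ maximalElements t n r,
        ∃! i : List ℤ, i ∈ gapSeqs m 2 n ∧ v.1 (fundWeight t n r) = rootSum t n i) ∧
    -- the case `2 ≤ r ≤ n - 1`, `n + 1 - r = 2m + 1`
    (∀ m : ℕ, 2 ≤ r → r < n → n + 1 = r + (2 * m + 1) →
      (∀ i ∈ gapSeqs m 3 n, ∃ v ∈ maximalElements t n r,
        v.1 (fundWeight t n r) = alphaOneCoeff t • simpleRoot t n 1 + rootSum t n i ∧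
        IsWindow v (windowOdd n i) ∧
        ∀ u ∈ minReps t n r,
          u.1 (fundWeight t n r) = alphaOneCoeff t • simpleRoot t n 1 + rootSum t n i → u = v) ∧
      ∀ v ∈ maximalElements t n r,
        ∃! i : List ℤ, i ∈ gapSeqs m 3 n ∧
          v.1 (fundWeight t n r) = alphaOneCoeff t • simpleRoot t n 1 + rootSum t n i) ∧
    -- the case `r = n`: `(2, 3, …, n, 1)`
    (r = n →
      ∃ v : weylGroup t n, maximalElements t n r = {v} ∧
        IsWindow v (((List.range (n - 1)).map fun k : ℕ => (k : ℤ) + 2) ++ [1])) := by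
  refine ⟨?_, ?_, ?_, ?_, ?_⟩
  · rintro p rfl hn
    exact maximalElements_one_even hrn hn
  · rintro p rfl hn
    exact maximalElements_one_odd hn
  · intro m h2 hlt hn
    exact maximalElements_even h2 hlt hn
  · intro m h2 hlt hn
    exact maximalElements_odd h2 hlt hn
  · rintro rfl
    exact maximalElements_last hr
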